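/- Let $\xi_{ij}$ be i.i.d. standard Gaussian variables, and for $\sigma\in\{\pm1\}^{N_1}$, $\tau\in\{\pm1\}^{N_2}$, $\beta>0$ let $$H_{N_1,N_2}(\sigma,\tau)=-\sqrt{\tfrac{2}{N_1+N_2}}\sum_{i=1}^{N_1}\sum_{j=1}^{N_2}\xi_{ij}\sigma_i\tau_j,\qquad Z_{N_1,N_2}(\beta)=\sum_{\sigma,\tau}e^{-\beta H_{N_1,N_2}(\sigma,\tau)},\qquad A_{N_1,N_2}(\beta)=\frac{1}{N_1+N_2}\,\mathbb E\log Z_{N_1,N_2}(\beta).$$ For a function $F$ of finitely many replicas $(\sigma^a,\tau^a)$ write $\langle F\rangle_{N_1,N_2}=\mathbb E\,\Omega(F)$, where $\Omega$ is the product, over the replicas, of the Boltzmann measure $e^{-\beta H_{N_1,N_2}}/Z_{N_1,N_2}(\beta)$ with the same $\xi$. Let $q_{ab}=\frac1{N_1}\sum_i\sigma_i^a\sigma_i^b$, $p_{ab}=\frac1{N_2}\sum_j\tau_j^a\tau_j^b$ and $$\Delta_{N_1,N_2}(\beta)=\langle q_{12}^2p_{12}^2\rangle_{N_1,N_2}-4\langle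 q_{12}p_{12}q_{23}p_{23}\rangle_{N_1,N_2}+3\langle q_{12}p_{12}q_{34}p_{34}\rangle_{N_1,N_2}.$$ Let $\alpha\in(0,1)$ and let $N_1=N_1(n)\to\infty$, $N_2=N_2(n)\to\infty$ be such that $N_1/(N_1+N_2)\to\alpha$ as $n\to\infty$ (the thermodynamic limit). Then: 1. If the limiting pressure $\lim_{n}A_{N_1,N_2}(\beta)=A(\alpha,\beta)$ exists for every $\beta>0$, then $\lim_{n}\Delta_{N_1,N_2}(\beta)=0$ for Lebesgue-almost every $\beta>0$. 2. Without assuming that the limiting pressure exists: for Lebesgue-almost every $\beta>0$, if the limits of $\langle q_{12}^2p_{12}^2\rangle_{N_1,N_2}$, $\langle q_{12}p_{12}q_{23}p_{23}\rangle_{N_1,N_2}$ and $\langle q_{12}p_{12}q_{34}p_{34}\rangle_{N_1,N_2}$ as $n\to\infty$ exist, then, denoting them by $\langle\cdot\rangle$, $$\langle q_{12}^2p_{12}^2\rangle-4\langle q_{12}p_{12}q_{23}p_{23}\rangle+3\langle q_{12}p_{12}q_{34}p_{34}\rangle=0.$$ 3. Without assuming that any of these limits exists: $\lim_{n}\int_0^B|\Delta_{N_1,N_2}(\beta)|\,d\beta=0$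 for every $B>0$. -/

import Mathlib

open MeasureTheory ProbabilityTheory Filter Topology

noncomputable section

namespace BipartiteSpinGlass

/-- Configurations of the two parties: `σ ∈ {±1}^N₁` and `τ ∈ {±1}^N₂` (`ℤˣ = {1, -1}`). -/
abbrev Config (N₁ N₂ : ℕ) : Type := (Fin N₁ → ℤˣ) × (Fin N₂ → ℤˣ)

/-- The numerical value `±1` of a spin. -/
def spin (s : ℤˣ) : ℝ := ((s : ℤ) : ℝ)

/-- A realisation of the couplings `ξ i j`. -/
abbrev Disorder (N₁ N₂ : ℕ) : Type := Fin N₁ × Fin N₂ → ℝ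

/-- The law of the quenched disorder: the `ξ i j` are i.i.d. standard Gaussians. -/
def disorderLaw (N₁ N₂ : ℕ) : Measure (Disorder N₁ N₂) :=
  Measure.pi fun _ => gaussianReal 0 1

/-- `H(σ, τ) = - √(2 / (N₁ + N₂)) ∑ i j, ξ i j σ i τ j`. -/
def hamiltonian {N₁ N₂ : ℕ} (ξ : Disorder N₁ N₂) (c : Config N₁ N₂) : ℝ :=
  -Real.sqrt (2 / ((N₁ : ℝ) + (N₂ : ℝ))) *
    ∑ i : Fin N₁, ∑ j : Fin N₂, ξ (i, j) * spin (c.1 i) * spin (c.2 j)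

/-- Partition function. -/
def partitionFn {N₁ N₂ : ℕ} (β : ℝ) (ξ : Disorder N₁ N₂) : ℝ :=
  ∑ c : Config N₁ N₂, Real.exp (-β * hamiltonian ξ c)

/-- Quenched pressure `(1 / (N₁ + N₂)) 𝔼 log Z`. -/
def pressure (N₁ N₂ : ℕ) (β : ℝ) : ℝ :=
  1 / ((N₁ : ℝ) + (N₂ : ℝ)) * ∫ ξ, Real.log (partitionFn β ξ) ∂(disorderLaw N₁ N₂)

/-- Boltzmann weight of a configuration. -/
def boltzmann {N₁ N₂ : ℕ} (β : ℝ) (ξ : Disorder N₁ N₂) (c : Config N₁ N₂) : ℝ :=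
  Real.exp (-β * hamiltonian ξ c) / partitionFn β ξ

/-- The product Boltzmann state `Ω` on `s` replicas sharing the same disorder. -/
def replicaState {N₁ N₂ : ℕ} (s : ℕ) (β : ℝ) (ξ : Disorder N₁ N₂)
    (F : (Fin s → Config N₁ N₂) → ℝ) : ℝ :=
  ∑ x : Fin s → Config N₁ N₂, F x * ∏ a : Fin s, boltzmann β ξ (x a)

/-- The average `⟨F⟩ = 𝔼 Ω(F)` of a function of `s` replicas. -/
def average {N₁ N₂ : ℕ} (s : ℕ) (β : ℝ) (F : (Fin s → Config N₁ N₂) → ℝ) : ℝ :=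
  ∫ ξ, replicaState s β ξ F ∂(disorderLaw N₁ N₂)

/-- Overlap of the replicas `a` and `b` in the first party. -/
def q {N₁ N₂ s : ℕ} (x : Fin s → Config N₁ N₂) (a b : Fin s) : ℝ :=
  1 / (N₁ : ℝ) * ∑ i : Fin N₁, spin ((x a).1 i) * spin ((x b).1 i)

/-- Overlap of the replicas `a` and `b` in the second party. -/
def p {N₁ N₂ s : ℕ} (x : Fin s → Config N₁ N₂) (a b : Fin s) : ℝ :=
  1 / (N₂ : ℝ) * ∑ j : Fin N₂, spin ((x a).2 j) * spin ((x b).2 j)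

/-- `⟨q₁₂² p₁₂²⟩` at finite volume (replicas are numbered from `0` in the code). -/
def avg1212 (N₁ N₂ : ℕ) (β : ℝ) : ℝ :=
  average 4 β fun x : Fin 4 → Config N₁ N₂ => q x 0 1 ^ 2 * p x 0 1 ^ 2

/-- `⟨q₁₂ p₁₂ q₂₃ p₂₃⟩` at finite volume. -/
def avg1223 (N₁ N₂ : ℕ) (β : ℝ) : ℝ :=
  average 4 β fun x : Fin 4 → Config N₁ N₂ => q x 0 1 * p x 0 1 * q x 1 2 * p x 1 2

/-- `⟨q₁₂ p₁₂ q₃₄ p₃₄⟩` at finite volume. -/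
def avg1234 (N₁ N₂ : ℕ) (β : ℝ) : ℝ :=
  average 4 β fun x : Fin 4 → Config N₁ N₂ => q x 0 1 * p x 0 1 * q x 2 3 * p x 2 3

end BipartiteSpinGlass

end

/-! The field `h = -H` is Gaussian with covariance `V q p`, where `V = 2 N₁ N₂ / (N₁ + N₂)` is of
the order of the volume. Put `F = q₁₂ p₁₂` and consider `𝔼 Ω(F (h(x¹) - h(x³)))`. Gaussian
integration by parts shows that it equals `β V Δ` (`expDiff_eq_mul_acDelta`). Since only a
difference of fields between replicas enters, thermal fluctuations alone control it: its absolute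
value is at most `√V + v/√V`, where `v` is the expected Gibbs variance of `h` (`abs_expDiff_le`).

Now `v` is the derivative in `β` of `m`, the expected Gibbs mean of `h`, and `0 ≤ m ≤ 2Vβ`.
Integrating over `β` gives `∫ |Δ| → 0`, which is part 3; Fatou's lemma then gives `liminf |Δ| = 0`
almost everywhere, hence part 2.

Part 1 is pointwise in `β`. The derivative of `β V Δ` is at most `16 v` in absolute value, so `β V
|Δ|` at `β` exceeds its value at a nearby `γ > β` by at most `16 (m(γ) - m(β))`. The mean value
theorem supplies a `γ` at which `v` is a difference quotient of `m` (`abs_acDelta_le_expMean_sub`).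
By convexity of `𝔼 log Z`, increments of `m` per unit volume are bounded by a gap between slopes of
the pressure. Letting `n → ∞` and then the step tend to zero, the gap vanishes wherever the limiting
pressure is differentiable, and that is almost everywhere because it is monotone. -/

/-! ### Gaussian integration by parts -/

theorem integral_id_mul_gaussianReal_eq_integral_deriv {f f' : ℝ → ℝ} {C C' : ℝ}
    (hf : ∀ x, HasDerivAt f (f' x) x) (hC : ∀ x, |f x| ≤ C) (hC' : ∀ x, |f' x| ≤ C')
    (hm : Measurable f') :
    ∫ x, x * f x ∂(gaussianReal 0 1) = ∫ x, f' x ∂(gaussianReal 0 1) := by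
  have hfm : Measurable f :=
    (continuous_iff_continuousAt.2 fun x => (hf x).continuousAt).measurable
  have hφ : ∀ x, HasDerivAt (gaussianPDFReal 0 1) (-(x * gaussianPDFReal 0 1 x)) x := by
    intro x
    have h1 : HasDerivAt (fun x : ℝ => -x ^ 2 / 2) (-x) x := by
      refine (((hasDerivAt_pow 2 x).neg).div_const 2).congr_deriv ?_
      norm_num
      ring
    have h2 := (h1.exp).const_mul (√(2 * Real.pi))⁻¹
    have h3 : gaussianPDFReal 0 1 = fun x => (√(2 * Real.pi))⁻¹ * Real.exp (-x ^ 2 / 2) := by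
      ext x; simp [gaussianPDFReal]
    rw [h3]
    exact h2.congr_deriv (by ring)
  have hint : Integrable (fun x : ℝ => x * gaussianPDFReal 0 1 x) := by
    have h := (memLp_id_gaussianReal (μ := 0) (v := 1) 1).integrable le_rfl
    rw [gaussianReal_of_var_ne_zero _ one_ne_zero,
      integrable_withDensity_iff_integrable_smul' (by fun_prop) (by simp [gaussianPDF])] at h
    simpa [mul_comm] using h
  have hφi := integrable_gaussianPDFReal 0 1
  have i1 : Integrable (fun x => f' x * gaussianPDFReal 0 1 x) :=
    hφi.bdd_mul hm.aestronglyMeasurable (ae_of_all _ hC')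
  have i2 : Integrable (fun x => f x * (x * gaussianPDFReal 0 1 x)) :=
    hint.bdd_mul hfm.aestronglyMeasurable (ae_of_all _ hC)
  have i3 : Integrable (fun x => f x * gaussianPDFReal 0 1 x) :=
    hφi.bdd_mul hfm.aestronglyMeasurable (ae_of_all _ hC)
  -- With `φ` the Gaussian density, `φ' = -x φ`, so the integral of `(f φ)' = f' φ - x f φ`
  -- vanishes.
  have key := integral_eq_zero_of_hasDerivAt_of_integrable
    (fun x => (hf x).mul (hφ x)) (by
      refine (i1.sub i2).congr (ae_of_all _ fun x => ?_)
      simp only [Pi.sub_apply]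
      ring) i3
  rw [integral_gaussianReal_eq_integral_smul one_ne_zero,
    integral_gaussianReal_eq_integral_smul one_ne_zero]
  have h0 : ∫ x, (f' x * gaussianPDFReal 0 1 x - f x * (x * gaussianPDFReal 0 1 x)) = 0 := by
    exact (integral_congr_ae (ae_of_all _ fun x => by ring)).trans key
  rw [integral_sub i1 i2, sub_eq_zero] at h0
  simp only [smul_eq_mul]
  calc _ = ∫ x, f x * (x * gaussianPDFReal 0 1 x) :=
      integral_congr_ae (ae_of_all _ fun x => by ring)
    _ = ∫ x, f' x * gaussianPDFReal 0 1 x := h0.symm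
    _ = _ :=
      integral_congr_ae (ae_of_all _ fun x => by ring)

section Update

variable {ι : Type*} [Fintype ι] [DecidableEq ι]

/-- Resampling one coordinate independently does not change a product law. This reduces integration
by parts in one coordinate to dimension one, by Fubini, without splitting the index set. -/
theorem measurePreserving_update_pi (μ : ι → Measure ℝ) [∀ i, IsProbabilityMeasure (μ i)] (i : ι) :
    MeasurePreserving (fun z : (ι → ℝ) × ℝ => Function.update z.1 i z.2)
      ((Measure.pi μ).prod (μ i)) (Measure.pi μ) := by
  have hmeas : Measurable (fun z : (ι → ℝ) × ℝ => Function.update z.1 i z.2) := by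
    rw [measurable_pi_iff]
    intro j
    by_cases h : j = i
    · subst h; simpa using measurable_snd
    · simp only [Function.update_of_ne h]; fun_prop
  refine ⟨hmeas, (Measure.pi_eq ?_).symm⟩
  intro s hs
  rw [Measure.map_apply hmeas (MeasurableSet.univ_pi hs)]
  have : (fun z : (ι → ℝ) × ℝ => Function.update z.1 i z.2) ⁻¹' Set.pi Set.univ s
      = (Set.pi Set.univ (Function.update s i Set.univ)) ×ˢ s i := by
    ext ⟨x, y⟩
    simp only [Set.mem_preimage, Set.mem_pi, Set.mem_univ, true_implies, Set.mem_prod]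
    constructor
    · intro h
      refine ⟨fun j => ?_, by simpa using h i⟩
      by_cases hj : j = i
      · subst hj; simp
      · simpa [hj] using h j
    · rintro ⟨h1, h2⟩ j
      by_cases hj : j = i
      · subst hj; simpa using h2
      · simpa [hj] using h1 j
  rw [this, Measure.prod_prod, Measure.pi_pi, ← Finset.prod_erase_mul _ _ (Finset.mem_univ i),
    ← Finset.prod_erase_mul (a := i) Finset.univ (fun i => μ i (s i)) (Finset.mem_univ i)]
  simp only [Function.update_self, measure_univ, mul_one]
  congr 1
  refine Finset.prod_congr rfl fun j hj => ?_
  rw [Function.update_of_ne (Finset.ne_of_mem_erase hj)]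

/-- The law of a family of independent standard Gaussians. -/
noncomputable abbrev stdGaussianPi (ι : Type*) [Fintype ι] : Measure (ι → ℝ) :=
  Measure.pi fun _ => gaussianReal 0 1

omit [DecidableEq ι] in
theorem memLp_two_eval_stdGaussianPi (k : ι) :
    MemLp (fun ξ : ι → ℝ => ξ k) 2 (stdGaussianPi ι) :=
  (memLp_id_gaussianReal (μ := 0) (v := 1) 2).comp_measurePreserving
    (measurePreserving_eval (fun _ : ι => gaussianReal 0 1) k)

omit [DecidableEq ι] in
theorem integrable_eval_stdGaussianPi (k : ι) :
    Integrable (fun ξ : ι → ℝ => ξ k) (stdGaussianPi ι) :=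
  (memLp_two_eval_stdGaussianPi k).integrable one_le_two

/-- Gaussian integration by parts in one coordinate. -/
theorem integral_eval_mul_stdGaussianPi {f f' : (ι → ℝ) → ℝ} {C C' : ℝ} (k : ι)
    (hf : ∀ ξ t, HasDerivAt (fun t => f (Function.update ξ k t)) (f' (Function.update ξ k t)) t)
    (hC : ∀ ξ, |f ξ| ≤ C) (hC' : ∀ ξ, |f' ξ| ≤ C') (hm : Measurable f) (hm' : Measurable f') :
    ∫ ξ, ξ k * f ξ ∂(stdGaussianPi ι) = ∫ ξ, f' ξ ∂(stdGaussianPi ι) := by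
  have mp := measurePreserving_update_pi (fun _ : ι => gaussianReal 0 1) k
  have i1 : Integrable (fun ξ : ι → ℝ => ξ k * f ξ) (stdGaussianPi ι) :=
    (integrable_eval_stdGaussianPi k).mul_bdd hm.aestronglyMeasurable (ae_of_all _ hC)
  have i2 : Integrable f' (stdGaussianPi ι) :=
    Integrable.of_bound hm'.aestronglyMeasurable C' (ae_of_all _ hC')
  have e : ∀ g : (ι → ℝ) → ℝ, Integrable g (stdGaussianPi ι) →
      ∫ ξ, g ξ ∂(stdGaussianPi ι)
        = ∫ ξ, ∫ t, g (Function.update ξ k t) ∂(gaussianReal 0 1) ∂(stdGaussianPi ι) := by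
    intro g hg
    rw [← integral_prod (fun z : (ι → ℝ) × ℝ => g (Function.update z.1 k z.2))
      (mp.integrable_comp_of_integrable hg)]
    conv_lhs => rw [stdGaussianPi, ← mp.map_eq]
    exact integral_map mp.measurable.aemeasurable (by rw [mp.map_eq]; exact hg.aestronglyMeasurable)
  rw [e _ i1, e _ i2]
  refine integral_congr_ae (ae_of_all _ fun ξ => ?_)
  simp only [Function.update_self]
  exact integral_id_mul_gaussianReal_eq_integral_deriv (hf ξ) (fun _ => hC _) (fun _ => hC' _)
    (hm'.comp (measurable_update ξ))

end Update

/-! ### Finite Gibbs measures and their replicas -/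

noncomputable section

namespace Gibbs

variable {C : Type*} [Fintype C]

/-- The Gibbs weights attached to the log-weights `E`. -/
def weight (E : C → ℝ) (c : C) : ℝ := Real.exp (E c) / ∑ c', Real.exp (E c')

/-- The mean of an observable. -/
def mean (E : C → ℝ) (f : C → ℝ) : ℝ := ∑ c, f c * weight E c

/-- The mean of a function of `s` independent replicas. -/
def replicaMean {s : ℕ} (E : C → ℝ) (F : (Fin s → C) → ℝ) : ℝ :=
  ∑ x : Fin s → C, F x * ∏ a, weight E (x a)

theorem weight_nonneg (E : C → ℝ) (c : C) : 0 ≤ weight E c := by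
  unfold weight; positivity

section Nonempty

variable [Nonempty C]

theorem sum_exp_pos (E : C → ℝ) : 0 < ∑ c, Real.exp (E c) :=
  Finset.sum_pos (fun _ _ => Real.exp_pos _) Finset.univ_nonempty

theorem sum_weight (E : C → ℝ) : ∑ c, weight E c = 1 := by
  simp only [weight, ← Finset.sum_div]
  exact div_self (sum_exp_pos E).ne'

theorem continuous_weight (c : C) : Continuous fun E : C → ℝ => weight E c := by
  unfold weight
  exact Continuous.div (by fun_prop) (by fun_prop) fun E => (sum_exp_pos E).ne'

theorem hasDerivAt_log_sum_exp {E : ℝ → C → ℝ} {E' : C → ℝ} {t : ℝ}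
    (hE : ∀ c, HasDerivAt (fun t => E t c) (E' c) t) :
    HasDerivAt (fun t => Real.log (∑ c, Real.exp (E t c))) (mean (E t) E') t := by
  have h := (HasDerivAt.fun_sum (u := Finset.univ) fun c _ => (hE c).exp).log (sum_exp_pos (E t)).ne'
  refine h.congr_deriv ?_
  rw [mean, Finset.sum_div]
  exact Finset.sum_congr rfl fun c _ => by rw [weight]; ring

theorem hasDerivAt_weight {E : ℝ → C → ℝ} {E' : C → ℝ} {t : ℝ}
    (hE : ∀ c, HasDerivAt (fun t => E t c) (E' c) t) (c : C) :
    HasDerivAt (fun t => weight (E t) c) (weight (E t) c * (E' c - mean (E t) E')) t := by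
  have hZ := sum_exp_pos (E t)
  -- In this form the logarithmic derivative of a weight is visibly the centred `E'`.
  have hw : ∀ t, weight (E t) c = Real.exp (E t c - Real.log (∑ c, Real.exp (E t c))) := by
    intro t
    rw [weight, Real.exp_sub, Real.exp_log (sum_exp_pos (E t))]
  simp_rw [hw]
  exact ((hE c).sub (hasDerivAt_log_sum_exp hE)).exp

theorem hasDerivAt_replicaMean {s : ℕ} {E : ℝ → C → ℝ} {E' : C → ℝ} {t : ℝ}
    (hE : ∀ c, HasDerivAt (fun t => E t c) (E' c) t) (F : (Fin s → C) → ℝ) :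
    HasDerivAt (fun t => replicaMean (E t) F)
      (replicaMean (E t) fun x => F x * ∑ a, (E' (x a) - mean (E t) E')) t := by
  unfold replicaMean
  refine HasDerivAt.fun_sum fun x _ => ?_
  have h := (HasDerivAt.fun_finsetProd (u := Finset.univ)
    (f := fun a t => weight (E t) (x a)) fun a _ => hasDerivAt_weight hE (x a)).const_mul (F x)
  refine h.congr_deriv ?_
  rw [mul_assoc, Finset.sum_mul]
  congr 1
  refine Finset.sum_congr rfl fun a _ => ?_
  rw [← Finset.prod_erase_mul _ _ (Finset.mem_univ a), smul_eq_mul]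
  ring

theorem hasDerivAt_mean {E : ℝ → C → ℝ} {E' : C → ℝ} {t : ℝ}
    (hE : ∀ c, HasDerivAt (fun t => E t c) (E' c) t) (f : C → ℝ) :
    HasDerivAt (fun t => mean (E t) f) (mean (E t) fun c => f c * (E' c - mean (E t) E')) t := by
  unfold mean
  refine HasDerivAt.fun_sum fun c _ => ?_
  refine ((hasDerivAt_weight hE c).const_mul (f c)).congr_deriv ?_
  rw [mean]; ring

end Nonempty

section Replica

variable {s : ℕ}

theorem replicaMean_mono {E : C → ℝ} {F G : (Fin s → C) → ℝ} (h : ∀ x, F x ≤ G x) :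
    replicaMean E F ≤ replicaMean E G :=
  Finset.sum_le_sum fun x _ =>
    mul_le_mul_of_nonneg_right (h x) (Finset.prod_nonneg fun _ _ => weight_nonneg _ _)

theorem abs_replicaMean_le (E : C → ℝ) (F : (Fin s → C) → ℝ) :
    |replicaMean E F| ≤ replicaMean E fun x => |F x| := by
  refine (Finset.abs_sum_le_sum_abs _ _).trans (Finset.sum_le_sum fun x _ => ?_)
  rw [abs_mul, abs_of_nonneg (Finset.prod_nonneg fun _ _ => weight_nonneg _ _)]

theorem replicaMean_add (E : C → ℝ) (F G : (Fin s → C) → ℝ) :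
    replicaMean E (fun x => F x + G x) = replicaMean E F + replicaMean E G := by
  simp only [replicaMean, add_mul, Finset.sum_add_distrib]

theorem replicaMean_sub (E : C → ℝ) (F G : (Fin s → C) → ℝ) :
    replicaMean E (fun x => F x - G x) = replicaMean E F - replicaMean E G := by
  simp only [replicaMean, sub_mul, Finset.sum_sub_distrib]

theorem replicaMean_const_mul (E : C → ℝ) (r : ℝ) (F : (Fin s → C) → ℝ) :
    replicaMean E (fun x => r * F x) = r * replicaMean E F := by
  simp only [replicaMean, Finset.mul_sum, mul_assoc]

theorem replicaMean_sum {ι : Type*} (t : Finset ι) (E : C → ℝ) (F : ι → (Fin s → C) → ℝ) :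
    replicaMean E (fun x => ∑ i ∈ t, F i x) = ∑ i ∈ t, replicaMean E (F i) := by
  simp only [replicaMean, Finset.sum_mul]
  exact Finset.sum_comm

theorem replicaMean_comp_perm (E : C → ℝ) (F : (Fin s → C) → ℝ) (π : Equiv.Perm (Fin s)) :
    replicaMean E (fun x => F (x ∘ π)) = replicaMean E F := by
  unfold replicaMean
  refine Fintype.sum_equiv (π.symm.arrowCongr (Equiv.refl C)) _ _ fun x => ?_
  have h : (π.symm.arrowCongr (Equiv.refl C)) x = x ∘ π := by ext; simp
  rw [h]
  congr 1
  exact (Equiv.prod_comp π fun a => weight E (x a)).symm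

/-- Replicas are independent given the disorder, so one can be summed out first. Read backwards,
this turns a Gibbs mean inside a replica average into an extra replica. -/
theorem replicaMean_removeNth (E : C → ℝ) (b : Fin (s + 1)) (G : (Fin s → C) → C → ℝ) :
    replicaMean E (fun x : Fin (s + 1) → C => G (b.removeNth x) (x b))
      = replicaMean E fun z => mean E (G z) := by
  unfold replicaMean mean
  rw [← (Fin.insertNthEquiv (fun _ => C) b).sum_comp, Fintype.sum_prod_type, Finset.sum_comm]
  simp only [Finset.sum_mul]
  refine Finset.sum_congr rfl fun z _ => Finset.sum_congr rfl fun y _ => ?_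
  have h : b.removeNth ((Fin.insertNthEquiv (fun _ => C) b) (y, z)) = z :=
    Fin.removeNth_insertNth (α := fun _ => C) b y z
  rw [h]
  simp only [Fin.insertNthEquiv_apply, Fin.insertNth_apply_same,
    Fin.prod_univ_succAbove _ b, Fin.insertNth_apply_succAbove]
  ring

variable [Nonempty C]

theorem replicaMean_const (E : C → ℝ) (r : ℝ) :
    replicaMean E (fun _ : Fin s → C => r) = r := by
  unfold replicaMean
  rw [← Finset.mul_sum]
  have := (Finset.prod_univ_sum (fun _ : Fin s => (Finset.univ : Finset C))
    (fun _ c => weight E c)).symm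
  rw [Fintype.piFinset_univ] at this
  rw [this]
  simp [sum_weight]

theorem mean_const (E : C → ℝ) (r : ℝ) : mean E (fun _ => r) = r := by
  unfold mean
  rw [← Finset.mul_sum, sum_weight, mul_one]

theorem abs_replicaMean_le_of_abs_le {E : C → ℝ} {F : (Fin s → C) → ℝ} {B : ℝ}
    (h : ∀ x, |F x| ≤ B) : |replicaMean E F| ≤ B :=
  (abs_replicaMean_le E F).trans ((replicaMean_mono h).trans_eq (replicaMean_const E B))

theorem replicaMean_eval (E : C → ℝ) (b : Fin (s + 1)) (f : C → ℝ) :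
    replicaMean E (fun x : Fin (s + 1) → C => f (x b)) = mean E f := by
  rw [replicaMean_removeNth E b (fun (_ : Fin s → C) c => f c), replicaMean_const]

theorem continuous_replicaMean {X : Type*} [TopologicalSpace X] {E : X → C → ℝ}
    {F : X → (Fin s → C) → ℝ} (hE : ∀ c, Continuous fun y => E y c)
    (hF : ∀ x, Continuous fun y => F y x) : Continuous fun y => replicaMean (E y) (F y) := by
  unfold replicaMean
  refine continuous_finsetSum _ fun x _ => (hF x).mul (continuous_finsetProd _ fun a _ => ?_)
  exact (continuous_weight (x a)).comp (continuous_pi hE)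

end Replica

section Mean

theorem mean_eq_replicaMean [Nonempty C] (E : C → ℝ) (f : C → ℝ) :
    mean E f = replicaMean E (fun x : Fin 1 → C => f (x 0)) :=
  (replicaMean_eval E 0 f).symm

theorem mean_mono {E f g : C → ℝ} (h : ∀ c, f c ≤ g c) : mean E f ≤ mean E g :=
  Finset.sum_le_sum fun c _ => mul_le_mul_of_nonneg_right (h c) (weight_nonneg _ _)

theorem mean_sub (E f g : C → ℝ) : mean E (fun c => f c - g c) = mean E f - mean E g := by
  simp only [mean, sub_mul, Finset.sum_sub_distrib]

theorem mean_add (E f g : C → ℝ) : mean E (fun c => f c + g c) = mean E f + mean E g := by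
  simp only [mean, add_mul, Finset.sum_add_distrib]

theorem mean_const_mul (E : C → ℝ) (r : ℝ) (f : C → ℝ) :
    mean E (fun c => r * f c) = r * mean E f := by
  simp only [mean, Finset.mul_sum, mul_assoc]

variable [Nonempty C]

theorem abs_mean_le_of_abs_le {E f : C → ℝ} {B : ℝ} (h : ∀ c, |f c| ≤ B) : |mean E f| ≤ B := by
  rw [mean_eq_replicaMean]
  exact abs_replicaMean_le_of_abs_le fun x => h (x 0)

theorem continuous_mean {X : Type*} [TopologicalSpace X] {E : X → C → ℝ}
    {f : X → C → ℝ} (hE : ∀ c, Continuous fun y => E y c)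
    (hf : ∀ c, Continuous fun y => f y c) : Continuous fun y => mean (E y) (f y) := by
  unfold mean
  exact continuous_finsetSum _ fun c _ =>
    (hf c).mul ((continuous_weight c).comp (continuous_pi hE))

/-- The Gibbs variance. -/
def variance (E f : C → ℝ) : ℝ := mean E fun c => (f c - mean E f) ^ 2

theorem variance_nonneg (E f : C → ℝ) : 0 ≤ variance E f := by
  unfold variance
  rw [← mean_const E 0]
  exact mean_mono fun c => sq_nonneg _

theorem mean_mul_sub_mean (E f : C → ℝ) :
    mean E (fun c => f c * (f c - mean E f)) = variance E f := by
  have h : ∀ c, f c * (f c - mean E f) = (f c - mean E f) ^ 2 + (mean E f * f c - mean E f * mean E f) :=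
    fun c => by ring
  simp only [h]
  rw [mean_add, mean_sub, mean_const_mul, mean_const, sub_self, add_zero, variance]

end Mean

end Gibbs

end

/-! ### Gaussian fields: derivatives in the inverse temperature and thermal fluctuations -/

noncomputable section

namespace Gibbs

variable {K C : Type*} [Fintype K] [Fintype C]

/-- The Gaussian field `∑ k, ξ k * u k c`. -/
def field (u : K → C → ℝ) (ξ : K → ℝ) (c : C) : ℝ := ∑ k, ξ k * u k c

/-- The covariance of the Gaussian field. -/
def cov (u : K → C → ℝ) (c c' : C) : ℝ := ∑ k, u k c * u k c'

/-- A uniform bound on the Gaussian field. -/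
def fieldBound (u : K → C → ℝ) (ξ : K → ℝ) : ℝ := ∑ k, |ξ k| * ∑ c, |u k c|

/-- Log-weights at inverse temperature `β`. -/
def logWeight (u : K → C → ℝ) (β : ℝ) (ξ : K → ℝ) (c : C) : ℝ := β * field u ξ c

variable (u : K → C → ℝ)

theorem abs_field_le (ξ : K → ℝ) (c : C) : |field u ξ c| ≤ fieldBound u ξ := by
  refine (Finset.abs_sum_le_sum_abs _ _).trans (Finset.sum_le_sum fun k _ => ?_)
  rw [abs_mul]
  exact mul_le_mul_of_nonneg_left
    (Finset.single_le_sum (f := fun c => |u k c|) (fun _ _ => abs_nonneg _) (Finset.mem_univ c))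
    (abs_nonneg _)

theorem memLp_fieldBound : MemLp (fieldBound u) 2 (stdGaussianPi K) := by
  unfold fieldBound
  refine memLp_finsetSum _ fun k _ => ?_
  simpa [mul_comm] using ((memLp_two_eval_stdGaussianPi k).abs).const_mul (∑ c, |u k c|)

theorem integrable_fieldBound : Integrable (fieldBound u) (stdGaussianPi K) :=
  (memLp_fieldBound u).integrable one_le_two

theorem integrable_fieldBound_sq : Integrable (fun ξ => fieldBound u ξ ^ 2) (stdGaussianPi K) :=
  (memLp_fieldBound u).integrable_sq

omit [Fintype C] in
theorem continuous_field (c : C) : Continuous fun ξ => field u ξ c := by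
  unfold field; fun_prop

omit [Fintype C] in
theorem continuous_logWeight (β : ℝ) (c : C) : Continuous fun ξ => logWeight u β ξ c :=
  (continuous_field u c).const_mul β

omit [Fintype C] in
theorem hasDerivAt_logWeight (β : ℝ) (ξ : K → ℝ) (c : C) :
    HasDerivAt (fun β => logWeight u β ξ c) (field u ξ c) β := by
  exact ((hasDerivAt_id β).mul_const (field u ξ c)).congr_deriv (one_mul _)

omit [Fintype C] in
theorem hasDerivAt_logWeight_update [DecidableEq K] (β : ℝ) (ξ : K → ℝ) (k : K) (t : ℝ) (c : C) :
    HasDerivAt (fun t => logWeight u β (Function.update ξ k t) c) (β * u k c) t := by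
  unfold logWeight field
  refine HasDerivAt.const_mul β ?_
  have h := HasDerivAt.fun_sum (u := Finset.univ) fun l _ =>
    ((hasDerivAt_pi.1 (hasDerivAt_update ξ k t)) l).mul_const (u l c)
  refine h.congr_deriv ?_
  simp [Pi.single_apply]

/-- Differentiation under a Gaussian expectation. -/
theorem hasDerivAt_integral_stdGaussianPi {Φ Φ' : ℝ → (K → ℝ) → ℝ} {g : (K → ℝ) → ℝ} {β : ℝ}
    (hΦ : ∀ t ξ, HasDerivAt (fun t => Φ t ξ) (Φ' t ξ) t) (hc : ∀ t, Continuous (Φ t))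
    (hc' : ∀ t, Continuous (Φ' t)) (hi : Integrable (Φ β) (stdGaussianPi K))
    (hg : Integrable g (stdGaussianPi K)) (hb : ∀ t ξ, |Φ' t ξ| ≤ g ξ) :
    HasDerivAt (fun t => ∫ ξ, Φ t ξ ∂(stdGaussianPi K)) (∫ ξ, Φ' β ξ ∂(stdGaussianPi K)) β :=
  (hasDerivAt_integral_of_dominated_loc_of_deriv_le (s := Set.univ) univ_mem
    (Eventually.of_forall fun t => (hc t).aestronglyMeasurable) hi (hc' β).aestronglyMeasurable
    (ae_of_all _ fun ξ t _ => hb t ξ) hg (ae_of_all _ fun ξ t _ => hΦ t ξ)).2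

variable [Nonempty C]

/-- Expected log-partition function. -/
def expLogZ (β : ℝ) : ℝ := ∫ ξ, Real.log (∑ c, Real.exp (logWeight u β ξ c)) ∂(stdGaussianPi K)

/-- Expected Gibbs mean of the field. -/
def expMean (β : ℝ) : ℝ := ∫ ξ, mean (logWeight u β ξ) (field u ξ) ∂(stdGaussianPi K)

/-- Expected Gibbs variance of the field. -/
def expVar (β : ℝ) : ℝ := ∫ ξ, variance (logWeight u β ξ) (field u ξ) ∂(stdGaussianPi K)

theorem continuous_mean_field (β : ℝ) :
    Continuous fun ξ => mean (logWeight u β ξ) (field u ξ) :=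
  continuous_mean (continuous_logWeight u β) (continuous_field u)

theorem continuous_variance_field (β : ℝ) :
    Continuous fun ξ => variance (logWeight u β ξ) (field u ξ) :=
  continuous_mean (continuous_logWeight u β) fun c =>
    ((continuous_field u c).sub (continuous_mean_field u β)).pow 2

theorem abs_mean_field_le (β : ℝ) (ξ : K → ℝ) :
    |mean (logWeight u β ξ) (field u ξ)| ≤ fieldBound u ξ :=
  abs_mean_le_of_abs_le (abs_field_le u ξ)

theorem abs_field_sub_mean_le (β : ℝ) (ξ : K → ℝ) (c : C) :
    |field u ξ c - mean (logWeight u β ξ) (field u ξ)| ≤ 2 * fieldBound u ξ := by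
  linarith [abs_sub (field u ξ c) (mean (logWeight u β ξ) (field u ξ)),
    abs_field_le u ξ c, abs_mean_field_le u β ξ]

theorem abs_variance_field_le (β : ℝ) (ξ : K → ℝ) :
    |variance (logWeight u β ξ) (field u ξ)| ≤ 4 * fieldBound u ξ ^ 2 := by
  refine abs_mean_le_of_abs_le fun c => ?_
  rw [abs_pow]
  nlinarith [abs_field_sub_mean_le u β ξ c,
    abs_nonneg (field u ξ c - mean (logWeight u β ξ) (field u ξ))]

theorem integrable_mean_field (β : ℝ) :
    Integrable (fun ξ => mean (logWeight u β ξ) (field u ξ)) (stdGaussianPi K) :=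
  (integrable_fieldBound u).mono' (continuous_mean_field u β).aestronglyMeasurable
    (ae_of_all _ (abs_mean_field_le u β))

theorem integrable_variance_field (β : ℝ) :
    Integrable (fun ξ => variance (logWeight u β ξ) (field u ξ)) (stdGaussianPi K) :=
  ((integrable_fieldBound_sq u).const_mul 4).mono'
    (continuous_variance_field u β).aestronglyMeasurable (ae_of_all _ (abs_variance_field_le u β))

theorem expVar_nonneg (β : ℝ) : 0 ≤ expVar u β :=
  integral_nonneg fun _ => variance_nonneg _ _

theorem continuous_log_sum_exp (β : ℝ) :
    Continuous fun ξ : K → ℝ => Real.log (∑ c, Real.exp (logWeight u β ξ c)) := by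
  have := continuous_logWeight u β
  exact Continuous.log (by fun_prop) fun ξ => (sum_exp_pos _).ne'

theorem abs_log_sum_exp_le (β : ℝ) (ξ : K → ℝ) :
    |Real.log (∑ c, Real.exp (logWeight u β ξ c))|
      ≤ Real.log (Fintype.card C) + |β| * fieldBound u ξ := by
  have hb : ∀ c, |logWeight u β ξ c| ≤ |β| * fieldBound u ξ := fun c => by
    rw [logWeight, abs_mul]
    exact mul_le_mul_of_nonneg_left (abs_field_le u ξ c) (abs_nonneg _)
  have hn : (0 : ℝ) < Fintype.card C := by exact_mod_cast Fintype.card_pos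
  have hZ := sum_exp_pos (logWeight u β ξ)
  have hn1 : 0 ≤ Real.log (Fintype.card C) :=
    Real.log_nonneg (by exact_mod_cast Fintype.card_pos (α := C))
  rw [abs_le]
  constructor
  · obtain ⟨c⟩ := ‹Nonempty C›
    have h1 : Real.exp (logWeight u β ξ c) ≤ ∑ c, Real.exp (logWeight u β ξ c) :=
      Finset.single_le_sum (f := fun c => Real.exp (logWeight u β ξ c))
        (fun _ _ => (Real.exp_pos _).le) (Finset.mem_univ c)
    have h2 := (Real.le_log_iff_exp_le hZ).2 h1
    linarith [neg_abs_le (logWeight u β ξ c), hb c]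
  · rw [Real.log_le_iff_le_exp hZ, Real.exp_add, Real.exp_log hn]
    calc _ ≤ ∑ _c : C, Real.exp (|β| * fieldBound u ξ) :=
          Finset.sum_le_sum fun c _ => Real.exp_le_exp.2 ((le_abs_self _).trans (hb c))
      _ = _ := by simp

theorem hasDerivAt_expLogZ (β : ℝ) : HasDerivAt (expLogZ u) (expMean u β) β := by
  refine hasDerivAt_integral_stdGaussianPi
    (fun t ξ => hasDerivAt_log_sum_exp (hasDerivAt_logWeight u t ξ))
    (continuous_log_sum_exp u) (continuous_mean_field u) ?_ (integrable_fieldBound u)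
    (abs_mean_field_le u)
  exact ((integrable_const _).add ((integrable_fieldBound u).const_mul |β|)).mono'
    (continuous_log_sum_exp u β).aestronglyMeasurable (ae_of_all _ (abs_log_sum_exp_le u β))

theorem hasDerivAt_expMean (β : ℝ) : HasDerivAt (expMean u) (expVar u β) β :=
  hasDerivAt_integral_stdGaussianPi
    (fun t ξ => (hasDerivAt_mean (hasDerivAt_logWeight u t ξ) (field u ξ)).congr_deriv
      (mean_mul_sub_mean _ _))
    (continuous_mean_field u) (continuous_variance_field u) (integrable_mean_field u β)
    ((integrable_fieldBound_sq u).const_mul 4) (abs_variance_field_le u)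

theorem monotone_expMean : Monotone (expMean u) :=
  monotone_of_deriv_nonneg (fun β => (hasDerivAt_expMean u β).differentiableAt) fun β => by
    rw [(hasDerivAt_expMean u β).deriv]; exact expVar_nonneg u β

section Replicas

variable {s : ℕ}

/-- Expected replica mean of an observable times a difference of fields. -/
def expDiff (F : (Fin s → C) → ℝ) (a b : Fin s) (β : ℝ) : ℝ :=
  ∫ ξ, replicaMean (logWeight u β ξ) (fun x => F x * (field u ξ (x a) - field u ξ (x b)))
    ∂(stdGaussianPi K)

variable {F : (Fin s → C) → ℝ}

/-- The Gibbs mean cancels in the difference of fields, so each field may be centred; then `|w| ≤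
l/2 + w²/(2l)` is applied to both and averaged. Fluctuations of the Gibbs mean over the disorder
never enter. -/
theorem abs_expDiff_le (hF : ∀ x, |F x| ≤ 1) (a b : Fin s) (β : ℝ) {l : ℝ} (hl : 0 < l) :
    |expDiff u F a b β| ≤ l + expVar u β / l := by
  obtain ⟨s, rfl⟩ : ∃ n, s = n + 1 := ⟨s - 1, by have := a.pos; omega⟩
  have h : ∀ ξ, |replicaMean (logWeight u β ξ)
      (fun x => F x * (field u ξ (x a) - field u ξ (x b)))|
      ≤ l + variance (logWeight u β ξ) (field u ξ) / l := by
    intro ξ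
    set m := mean (logWeight u β ξ) (field u ξ) with hm
    refine (abs_replicaMean_le _ _).trans ?_
    have h1 : ∀ x : Fin (s + 1) → C, |F x * (field u ξ (x a) - field u ξ (x b))|
        ≤ l + (1 / (2 * l) * (field u ξ (x a) - m) ^ 2
          + 1 / (2 * l) * (field u ξ (x b) - m) ^ 2) := by
      intro x
      rw [abs_mul]
      set y := field u ξ (x a) - m with hy
      set z := field u ξ (x b) - m with hz
      have e : field u ξ (x a) - field u ξ (x b) = y - z := by rw [hy, hz]; ring
      have e1 : |F x| * |y - z| ≤ |y - z| := mul_le_of_le_one_left (abs_nonneg _) (hF x)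
      have e2 : ∀ w : ℝ, |w| ≤ l / 2 + 1 / (2 * l) * w ^ 2 := by
        intro w
        have : l / 2 + 1 / (2 * l) * w ^ 2 - |w| = (|w| - l) ^ 2 / (2 * l) := by
          rw [← sq_abs w]; field_simp; ring
        have : 0 ≤ (|w| - l) ^ 2 / (2 * l) := by positivity
        linarith
      rw [e]
      linarith [abs_sub y z, e2 y, e2 z]
    refine (replicaMean_mono h1).trans_eq ?_
    rw [replicaMean_add, replicaMean_add, replicaMean_const,
      replicaMean_eval _ a fun c => 1 / (2 * l) * (field u ξ c - m) ^ 2,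
      replicaMean_eval _ b fun c => 1 / (2 * l) * (field u ξ c - m) ^ 2,
      mean_const_mul, variance, ← hm]
    ring
  unfold expDiff
  refine (abs_integral_le_integral_abs).trans ?_
  have hi := (integrable_variance_field u β).div_const l
  refine (integral_mono_of_nonneg (ae_of_all _ fun _ => abs_nonneg _)
    ((integrable_const l).add hi) (ae_of_all _ h)).trans_eq ?_
  simp only [Pi.add_apply]
  rw [integral_add (integrable_const l) hi, integral_div, expVar]
  simp

theorem continuous_replicaMean_mul_sub (F : (Fin s → C) → ℝ) (a b : Fin s) (β : ℝ) :
    Continuous fun ξ => replicaMean (logWeight u β ξ)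
      (fun x => F x * (field u ξ (x a) - field u ξ (x b))) :=
  continuous_replicaMean (continuous_logWeight u β) fun x =>
    ((continuous_field u (x a)).sub (continuous_field u (x b))).const_mul (F x)

theorem abs_replicaMean_mul_sub_mul_sum_le {F : (Fin 4 → C) → ℝ} (hF : ∀ x, |F x| ≤ 1)
    (a b : Fin 4) (E h : C → ℝ) :
    |replicaMean E (fun x => F x * (h (x a) - h (x b)) * ∑ c, (h (x c) - mean E h))|
      ≤ 16 * variance E h := by
  refine (abs_replicaMean_le _ _).trans ?_
  have h1 : ∀ x : Fin 4 → C, |F x * (h (x a) - h (x b)) * ∑ c, (h (x c) - mean E h)|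
      ≤ 4 * ∑ c, (h (x c) - mean E h) ^ 2 := by
    intro x
    set y : Fin 4 → ℝ := fun c => h (x c) - mean E h with hy
    have e : h (x a) - h (x b) = y a - y b := by simp [hy]
    change |F x * (h (x a) - h (x b)) * ∑ c, y c| ≤ 4 * ∑ c, y c ^ 2
    rw [e, mul_assoc, abs_mul]
    refine (mul_le_of_le_one_left (abs_nonneg _) (hF x)).trans ?_
    have hs : ∀ c, y c ^ 2 ≤ ∑ c, y c ^ 2 := fun c =>
      Finset.single_le_sum (f := fun c => y c ^ 2) (fun _ _ => sq_nonneg _) (Finset.mem_univ c)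
    have hq : (∑ c, y c) ^ 2 ≤ 4 * ∑ c, y c ^ 2 := by
      simpa using sq_sum_le_card_mul_sum_sq (s := Finset.univ) (f := y)
    have ha := hs a
    have hb := hs b
    rw [abs_le]
    -- With `S = ∑ y c`: `2|(y a - y b) S| ≤ (y a - y b)² + S²`, and each square is at most `4 ∑ y
    -- c²`. Averaging over the four replicas then gives the constant 16.
    constructor <;> nlinarith [sq_nonneg (y a + y b), sq_nonneg (y a - y b + ∑ c, y c),
      sq_nonneg (y a - y b - ∑ c, y c)]
  refine (replicaMean_mono h1).trans_eq ?_
  rw [replicaMean_const_mul, replicaMean_sum]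
  simp only [replicaMean_eval E _ fun c => (h c - mean E h) ^ 2]
  rw [← variance]
  simp
  ring

/-- Since `expVar` is the derivative of `expMean`, this bounds the oscillation of `expDiff` by
increments of `expMean`. -/
theorem exists_hasDerivAt_expDiff {F : (Fin 4 → C) → ℝ} (hF : ∀ x, |F x| ≤ 1) (a b : Fin 4)
    (β : ℝ) : ∃ D, HasDerivAt (expDiff u F a b) D β ∧ |D| ≤ 16 * expVar u β := by
  set Φ' : ℝ → (K → ℝ) → ℝ := fun t ξ => replicaMean (logWeight u t ξ) (fun x =>
    F x * (field u ξ (x a) - field u ξ (x b)) *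
      ∑ c, (field u ξ (x c) - mean (logWeight u t ξ) (field u ξ))) with hΦ'
  have hb : ∀ t ξ, |Φ' t ξ| ≤ 16 * variance (logWeight u t ξ) (field u ξ) := fun t ξ =>
    abs_replicaMean_mul_sub_mul_sum_le hF a b _ _
  have hb' : ∀ t ξ, |Φ' t ξ| ≤ 64 * fieldBound u ξ ^ 2 := fun t ξ => by
    linarith [hb t ξ, le_abs_self (variance (logWeight u t ξ) (field u ξ)),
      abs_variance_field_le u t ξ]
  refine ⟨∫ ξ, Φ' β ξ ∂(stdGaussianPi K), ?_, ?_⟩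
  · refine hasDerivAt_integral_stdGaussianPi
      (fun t ξ => hasDerivAt_replicaMean (hasDerivAt_logWeight u t ξ) _)
      (continuous_replicaMean_mul_sub u F a b) ?_ ?_
      ((integrable_fieldBound_sq u).const_mul 64) hb'
    · intro t
      refine continuous_replicaMean (continuous_logWeight u t) fun x => ?_
      exact (((continuous_field u (x a)).sub (continuous_field u (x b))).const_mul (F x)).mul
        (continuous_finsetSum _ fun c _ => (continuous_field u (x c)).sub (continuous_mean_field u t))
    · refine ((integrable_fieldBound u).const_mul 2).mono'
        (continuous_replicaMean_mul_sub u F a b β).aestronglyMeasurable (ae_of_all _ fun ξ => ?_)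
      refine abs_replicaMean_le_of_abs_le fun x => ?_
      rw [abs_mul]
      refine (mul_le_of_le_one_left (abs_nonneg _) (hF x)).trans ?_
      linarith [abs_sub (field u ξ (x a)) (field u ξ (x b)), abs_field_le u ξ (x a),
        abs_field_le u ξ (x b)]
  · refine (abs_integral_le_integral_abs).trans ?_
    rw [expVar, ← integral_const_mul]
    exact integral_mono_of_nonneg (ae_of_all _ fun _ => abs_nonneg _)
      ((integrable_variance_field u β).const_mul 16) (ae_of_all _ (hb β))

end Replicas

end Gibbs

end

/-! ### Integration by parts for replicas and the Aizenman-Contucci polynomial -/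

noncomputable section

namespace Gibbs

variable {K C : Type*} [Fintype K] [Fintype C] [Nonempty C] (u : K → C → ℝ) {s : ℕ}

omit [Nonempty C] in
theorem replicaMean_cov_eq (E : C → ℝ) (F : (Fin s → C) → ℝ) (a : Fin s) :
    ∑ k, replicaMean E (fun x => F x * u k (x a) * ∑ b, (u k (x b) - mean E (u k)))
      = replicaMean E fun x =>
          F x * ∑ b, (cov u (x a) (x b) - mean E fun c => cov u (x a) c) := by
  rw [← replicaMean_sum]
  congr 1
  ext x
  have hm : (mean E fun c => cov u (x a) c) = ∑ k, u k (x a) * mean E (u k) := by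
    unfold mean cov
    simp only [Finset.sum_mul, Finset.mul_sum]
    rw [Finset.sum_comm]
    simp only [mul_assoc]
  simp only [hm]
  simp only [cov, ← Finset.sum_sub_distrib]
  simp only [Finset.mul_sum]
  rw [Finset.sum_comm]
  refine Finset.sum_congr rfl fun b _ => Finset.sum_congr rfl fun k _ => ?_
  ring

theorem continuous_replicaMean_logWeight (β : ℝ) (F : (Fin s → C) → ℝ) :
    Continuous fun ξ => replicaMean (logWeight u β ξ) F :=
  continuous_replicaMean (continuous_logWeight u β) fun _ => continuous_const

/-- Integration by parts is applied to each `ξ k`, on which the log-weights depend with slope `β * u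
k c`. Summing over `k` contracts the coefficients into covariances. -/
theorem integral_replicaMean_mul_field (F : (Fin s → C) → ℝ) (a : Fin s) (β : ℝ) :
    ∫ ξ, replicaMean (logWeight u β ξ) (fun x => F x * field u ξ (x a)) ∂(stdGaussianPi K)
      = β * ∫ ξ, replicaMean (logWeight u β ξ) (fun x => F x *
          ∑ b, (cov u (x a) (x b) - mean (logWeight u β ξ) fun c => cov u (x a) c))
          ∂(stdGaussianPi K) := by
  classical
  obtain ⟨B, hB⟩ : ∃ B, ∀ k c, |u k c| ≤ B := by
    obtain ⟨B, hB⟩ := (Set.finite_range fun z : K × C => |u z.1 z.2|).bddAbove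
    exact ⟨B, fun k c => hB ⟨(k, c), rfl⟩⟩
  obtain ⟨A, hA⟩ : ∃ A, ∀ k x, |F x * u k (x a)| ≤ A := by
    obtain ⟨B, hB⟩ := (Set.finite_range fun z : K × (Fin s → C) => |F z.2 * u z.1 (z.2 a)|).bddAbove
    exact ⟨B, fun k c => hB ⟨(k, c), rfl⟩⟩
  have hbd : ∀ k ξ x, |F x * u k (x a) * ∑ b, (u k (x b) - mean (logWeight u β ξ) (u k))|
      ≤ A * (s * (2 * B)) := by
    intro k ξ x
    rw [abs_mul]
    refine mul_le_mul (hA k x) ?_ (abs_nonneg _) ((abs_nonneg _).trans (hA k x))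
    refine (Finset.abs_sum_le_sum_abs _ _).trans ?_
    refine (Finset.sum_le_sum fun b _ => (abs_sub _ _).trans
      (add_le_add (hB k (x b)) (abs_mean_le_of_abs_le (hB k)))).trans_eq ?_
    simp; ring
  have hcont : ∀ k, Continuous fun ξ => replicaMean (logWeight u β ξ)
      (fun x => F x * u k (x a) * ∑ b, (u k (x b) - mean (logWeight u β ξ) (u k))) := fun k =>
    continuous_replicaMean (continuous_logWeight u β) fun x => continuous_const.mul
      (continuous_finsetSum _ fun b _ => continuous_const.sub
        (continuous_mean (continuous_logWeight u β) fun _ => continuous_const))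
  have ibp : ∀ k, ∫ ξ, ξ k * replicaMean (logWeight u β ξ) (fun x => F x * u k (x a))
        ∂(stdGaussianPi K)
      = β * ∫ ξ, replicaMean (logWeight u β ξ)
        (fun x => F x * u k (x a) * ∑ b, (u k (x b) - mean (logWeight u β ξ) (u k)))
        ∂(stdGaussianPi K) := by
    intro k
    rw [← integral_const_mul]
    refine integral_eval_mul_stdGaussianPi (C := A) (C' := |β| * (A * (s * (2 * B)))) k ?_
      (fun ξ => abs_replicaMean_le_of_abs_le (hA k)) ?_
      (continuous_replicaMean_logWeight u β _).measurable
      ((hcont k).const_mul β).measurable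
    · intro ξ t
      refine (hasDerivAt_replicaMean (hasDerivAt_logWeight_update u β ξ k t) _).congr_deriv ?_
      rw [← replicaMean_const_mul]
      congr 1
      ext x
      rw [mean_const_mul]
      simp only [← mul_sub, ← Finset.mul_sum]
      ring
    · intro ξ
      rw [abs_mul]
      exact mul_le_mul_of_nonneg_left (abs_replicaMean_le_of_abs_le (hbd k ξ)) (abs_nonneg _)
  have e1 : ∀ ξ : K → ℝ, replicaMean (logWeight u β ξ) (fun x => F x * field u ξ (x a))
      = ∑ k, ξ k * replicaMean (logWeight u β ξ) (fun x => F x * u k (x a)) := by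
    intro ξ
    simp only [← replicaMean_const_mul]
    rw [← replicaMean_sum]
    congr 1
    ext x
    rw [field, Finset.mul_sum]
    exact Finset.sum_congr rfl fun k _ => by ring
  simp only [e1, ← replicaMean_cov_eq]
  rw [integral_finsetSum, integral_finsetSum, Finset.mul_sum]
  · exact Finset.sum_congr rfl fun k _ => ibp k
  · intro k _
    exact Integrable.of_bound (hcont k).aestronglyMeasurable _
      (ae_of_all _ fun ξ => abs_replicaMean_le_of_abs_le (hbd k ξ))
  · intro k _
    exact (integrable_eval_stdGaussianPi k).mul_bdd
      (continuous_replicaMean_logWeight u β _).aestronglyMeasurable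
      (ae_of_all _ fun ξ => abs_replicaMean_le_of_abs_le (hA k))

omit [Fintype C] [Nonempty C] in
theorem cov_comm (c c' : C) : cov u c c' = cov u c' c := by
  simp only [cov, mul_comm]

variable {u} {V : ℝ}

/-- Integration by parts with one replica and `F = 1` gives `β` times an average of `V` minus a
covariance. Hence `expVar` has integral of order `V` over a bounded interval of `β`. -/
theorem expMean_mem_Icc (hV : ∀ c c', |cov u c c'| ≤ V) {β : ℝ} (hβ : 0 ≤ β)
    (hd : ∀ c, cov u c c = V) :
    0 ≤ expMean u β ∧ expMean u β ≤ 2 * V * β := by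
  have h := integral_replicaMean_mul_field u (fun _ : Fin 1 → C => 1) 0 β
  simp only [one_mul, Fin.sum_univ_one] at h
  have e : expMean u β = β * ∫ ξ, replicaMean (logWeight u β ξ) (fun x : Fin 1 → C =>
      cov u (x 0) (x 0) - mean (logWeight u β ξ) fun c => cov u (x 0) c) ∂(stdGaussianPi K) := by
    rw [← h, expMean]
    simp only [mean_eq_replicaMean]
  have hb : ∀ ξ (x : Fin 1 → C), |mean (logWeight u β ξ) fun c => cov u (x 0) c| ≤ V :=
    fun ξ x => abs_mean_le_of_abs_le (hV (x 0))
  have h1 : ∀ ξ, 0 ≤ replicaMean (logWeight u β ξ) (fun x : Fin 1 → C =>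
      cov u (x 0) (x 0) - mean (logWeight u β ξ) fun c => cov u (x 0) c) := by
    intro ξ
    rw [← replicaMean_const (s := 1) (logWeight u β ξ) 0]
    refine replicaMean_mono fun x => ?_
    rw [hd]
    linarith [le_abs_self (mean (logWeight u β ξ) fun c => cov u (x 0) c), hb ξ x]
  have h2 : ∀ ξ, replicaMean (logWeight u β ξ) (fun x : Fin 1 → C =>
      cov u (x 0) (x 0) - mean (logWeight u β ξ) fun c => cov u (x 0) c) ≤ 2 * V := by
    intro ξ
    rw [← replicaMean_const (s := 1) (logWeight u β ξ) (2 * V)]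
    refine replicaMean_mono fun x => ?_
    rw [hd]
    linarith [neg_abs_le (mean (logWeight u β ξ) fun c => cov u (x 0) c), hb ξ x]
  rw [e]
  refine ⟨mul_nonneg hβ (integral_nonneg h1), ?_⟩
  rw [mul_comm]
  refine mul_le_mul_of_nonneg_right ?_ hβ
  refine (integral_mono_of_nonneg (ae_of_all _ h1) (integrable_const _)
    (ae_of_all _ h2)).trans_eq ?_
  simp

/-- The Aizenman-Contucci combination of the covariance. -/
def acPoly (u : K → C → ℝ) (x : Fin 4 → C) : ℝ :=
  cov u (x 0) (x 1) ^ 2 - 4 * (cov u (x 0) (x 1) * cov u (x 1) (x 2))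
    + 3 * (cov u (x 0) (x 1) * cov u (x 2) (x 3))

/-- Write `Cab` for the covariances. The constant diagonal and `C01 C02` cancel in the difference;
`C01 C03` and `C01 C12` have equal means. The Gibbs means, subtracted once for each of the four `b`,
contribute `-4 C01 C12 + 4 C01 C23`, and the sum over `b` contributes `-C01 C23`. -/
theorem replicaMean_cov_eq_acPoly (hd : ∀ c, cov u c c = V) (E : C → ℝ) :
    replicaMean E (fun x : Fin 4 → C => cov u (x 0) (x 1) *
        ∑ b, (cov u (x 0) (x b) - mean E fun c => cov u (x 0) c))
      - replicaMean E (fun x : Fin 4 → C => cov u (x 0) (x 1) *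
        ∑ b, (cov u (x 2) (x b) - mean E fun c => cov u (x 2) c))
      = replicaMean E (acPoly u) := by
  -- Replica 3 does not occur in the other factors, so it can carry the Gibbs mean.
  have r0 : replicaMean E (fun x : Fin 4 → C => cov u (x 0) (x 1) * mean E fun c => cov u (x 0) c)
      = replicaMean E (fun x : Fin 4 → C => cov u (x 0) (x 1) * cov u (x 0) (x 3)) := by
    have h1 := replicaMean_removeNth E 3
      (fun (z : Fin 3 → C) (_ : C) => cov u (z 0) (z 1) * mean E fun c => cov u (z 0) c)
    have h2 := replicaMean_removeNth E 3
      (fun (z : Fin 3 → C) (c : C) => cov u (z 0) (z 1) * cov u (z 0) c)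
    simp only [mean_const] at h1
    simp only [mean_const_mul] at h2
    exact h1.trans h2.symm
  have r2 : replicaMean E (fun x : Fin 4 → C => cov u (x 0) (x 1) * mean E fun c => cov u (x 2) c)
      = replicaMean E (fun x : Fin 4 → C => cov u (x 0) (x 1) * cov u (x 2) (x 3)) := by
    have h1 := replicaMean_removeNth E 3
      (fun (z : Fin 3 → C) (_ : C) => cov u (z 0) (z 1) * mean E fun c => cov u (z 2) c)
    have h2 := replicaMean_removeNth E 3
      (fun (z : Fin 3 → C) (c : C) => cov u (z 0) (z 1) * cov u (z 2) c)
    simp only [mean_const] at h1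
    simp only [mean_const_mul] at h2
    exact h1.trans h2.symm
  have sym : replicaMean E (fun x : Fin 4 → C => cov u (x 0) (x 1) * cov u (x 0) (x 3))
      = replicaMean E (fun x : Fin 4 → C => cov u (x 0) (x 1) * cov u (x 1) (x 2)) := by
    rw [← replicaMean_comp_perm E _ (Equiv.swap (0 : Fin 4) 1 * Equiv.swap 2 3)]
    congr 1
    ext x
    have e0 : (Equiv.swap (0 : Fin 4) 1 * Equiv.swap 2 3 : Equiv.Perm (Fin 4)) 0 = 1 := by decide
    have e1 : (Equiv.swap (0 : Fin 4) 1 * Equiv.swap 2 3 : Equiv.Perm (Fin 4)) 1 = 0 := by decide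
    have e3 : (Equiv.swap (0 : Fin 4) 1 * Equiv.swap 2 3 : Equiv.Perm (Fin 4)) 3 = 2 := by decide
    simp only [Function.comp, e0, e1, e3]
    rw [cov_comm u (x 1) (x 0)]
  rw [← replicaMean_sub]
  have e : (fun x : Fin 4 → C =>
      cov u (x 0) (x 1) * ∑ b, (cov u (x 0) (x b) - mean E fun c => cov u (x 0) c)
        - cov u (x 0) (x 1) * ∑ b, (cov u (x 2) (x b) - mean E fun c => cov u (x 2) c))
      = fun x => ((cov u (x 0) (x 1) ^ 2 + cov u (x 0) (x 1) * cov u (x 0) (x 3))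
          - (cov u (x 0) (x 1) * cov u (x 1) (x 2) + cov u (x 0) (x 1) * cov u (x 2) (x 3)))
        - (4 * (cov u (x 0) (x 1) * mean E fun c => cov u (x 0) c)
          - 4 * (cov u (x 0) (x 1) * mean E fun c => cov u (x 2) c)) := by
    ext x
    simp only [Fin.sum_univ_four, hd]
    rw [cov_comm u (x 2) (x 0), cov_comm u (x 2) (x 1)]
    ring
  rw [e, replicaMean_sub, replicaMean_sub, replicaMean_sub, replicaMean_add, replicaMean_add,
    replicaMean_const_mul, replicaMean_const_mul, r0, r2, sym]
  unfold acPoly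
  rw [replicaMean_add, replicaMean_sub, replicaMean_const_mul, replicaMean_const_mul]
  ring

/-- The expected normalised Aizenman-Contucci combination. -/
def acDelta (u : K → C → ℝ) (V β : ℝ) : ℝ :=
  ∫ ξ, replicaMean (logWeight u β ξ) (fun x : Fin 4 → C => acPoly u x / V ^ 2) ∂(stdGaussianPi K)

end Gibbs

end

/-! ### Bounds on the normalised combination -/

noncomputable section

namespace Gibbs

variable {K C : Type*} [Fintype K] [Fintype C] [Nonempty C] {u : K → C → ℝ} {V : ℝ}

theorem integrable_replicaMean_mul_field {s : ℕ} (F : (Fin s → C) → ℝ) (a : Fin s) (β : ℝ) :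
    Integrable (fun ξ => replicaMean (logWeight u β ξ) (fun x => F x * field u ξ (x a)))
      (stdGaussianPi K) := by
  obtain ⟨A, hA⟩ := (Set.finite_range fun x => |F x|).bddAbove
  refine ((integrable_fieldBound u).const_mul A).mono'
    (continuous_replicaMean (continuous_logWeight u β) fun x =>
      (continuous_field u (x a)).const_mul (F x)).aestronglyMeasurable (ae_of_all _ fun ξ => ?_)
  refine abs_replicaMean_le_of_abs_le fun x => ?_
  rw [abs_mul]
  exact mul_le_mul (hA ⟨x, rfl⟩) (abs_field_le u ξ _) (abs_nonneg _)
    ((abs_nonneg _).trans (hA ⟨x, rfl⟩))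

theorem integrable_replicaMean_mul_sum_cov {s : ℕ} (F : (Fin s → C) → ℝ) (a : Fin s) (β : ℝ) :
    Integrable (fun ξ => replicaMean (logWeight u β ξ) (fun x => F x *
      ∑ b, (cov u (x a) (x b) - mean (logWeight u β ξ) fun c => cov u (x a) c)))
      (stdGaussianPi K) := by
  obtain ⟨A, hA⟩ := (Set.finite_range fun x => |F x|).bddAbove
  obtain ⟨B, hB⟩ := (Set.finite_range fun z : C × C => |cov u z.1 z.2|).bddAbove
  have hB' : ∀ c c', |cov u c c'| ≤ B := fun c c' => hB ⟨(c, c'), rfl⟩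
  have hc : Continuous fun ξ => replicaMean (logWeight u β ξ) (fun x => F x *
      ∑ b, (cov u (x a) (x b) - mean (logWeight u β ξ) fun c => cov u (x a) c)) := by
    refine continuous_replicaMean (continuous_logWeight u β) fun x => ?_
    have hm : Continuous fun ξ => mean (logWeight u β ξ) fun c => cov u (x a) c :=
      continuous_mean (continuous_logWeight u β) fun _ => continuous_const
    fun_prop
  refine Integrable.of_bound (C := A * (s * (2 * B))) hc.aestronglyMeasurable
    (ae_of_all _ fun ξ => ?_)
  rw [Real.norm_eq_abs]
  refine abs_replicaMean_le_of_abs_le fun x => ?_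
  rw [abs_mul]
  refine mul_le_mul (hA ⟨x, rfl⟩) ?_ (abs_nonneg _) ((abs_nonneg _).trans (hA ⟨x, rfl⟩))
  refine (Finset.abs_sum_le_sum_abs _ _).trans ?_
  refine (Finset.sum_le_sum fun b _ => (abs_sub _ _).trans
    (add_le_add (hB' (x a) (x b)) (abs_mean_le_of_abs_le (hB' (x a))))).trans_eq ?_
  simp; ring

omit [Fintype C] [Nonempty C] in
theorem abs_cov_div_le (hV0 : 0 < V) (hV : ∀ c c', |cov u c c'| ≤ V) (c c' : C) :
    |cov u c c' / V| ≤ 1 := by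
  rw [abs_div, abs_of_pos hV0]
  exact div_le_one_of_le₀ (hV c c') hV0.le

theorem expDiff_eq_mul_acDelta (hV0 : 0 < V) (hd : ∀ c, cov u c c = V) (β : ℝ) :
    expDiff u (fun x : Fin 4 → C => cov u (x 0) (x 1) / V) 0 2 β = β * V * acDelta u V β := by
  have e : expDiff u (fun x : Fin 4 → C => cov u (x 0) (x 1) / V) 0 2 β
      = V⁻¹ * ((∫ ξ, replicaMean (logWeight u β ξ)
          (fun x : Fin 4 → C => cov u (x 0) (x 1) * field u ξ (x 0)) ∂(stdGaussianPi K))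
        - ∫ ξ, replicaMean (logWeight u β ξ)
          (fun x : Fin 4 → C => cov u (x 0) (x 1) * field u ξ (x 2)) ∂(stdGaussianPi K)) := by
    rw [← integral_sub (integrable_replicaMean_mul_field _ _ _)
      (integrable_replicaMean_mul_field _ _ _), ← integral_const_mul, expDiff]
    refine integral_congr_ae (ae_of_all _ fun ξ => ?_)
    simp only
    rw [← replicaMean_sub, ← replicaMean_const_mul]
    congr 1
    ext x
    field_simp
  have hi := fun a => integrable_replicaMean_mul_sum_cov (u := u)
    (fun x : Fin 4 → C => cov u (x 0) (x 1)) a β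
  rw [e, integral_replicaMean_mul_field, integral_replicaMean_mul_field, ← mul_sub,
    ← integral_sub (hi 0) (hi 2)]
  simp only [replicaMean_cov_eq_acPoly hd]
  have e2 : acDelta u V β = (V ^ 2)⁻¹ *
      ∫ ξ, replicaMean (logWeight u β ξ) (acPoly u) ∂(stdGaussianPi K) := by
    rw [acDelta, ← integral_const_mul]
    simp only [← replicaMean_const_mul, div_eq_inv_mul]
  rw [e2]
  field_simp

omit [Fintype C] [Nonempty C] in
theorem abs_acPoly_div_le (hV0 : 0 < V) (hV : ∀ c c', |cov u c c'| ≤ V) (x : Fin 4 → C) :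
    |acPoly u x / V ^ 2| ≤ 8 := by
  have h : ∀ a b c d : Fin 4, |cov u (x a) (x b) * cov u (x c) (x d)| ≤ V ^ 2 := by
    intro a b c d
    rw [abs_mul, sq]
    exact mul_le_mul (hV _ _) (hV _ _) (abs_nonneg _) hV0.le
  rw [abs_div, abs_of_pos (by positivity : 0 < V ^ 2), div_le_iff₀ (by positivity), acPoly, sq]
  have h1 := abs_le.1 (h 0 1 0 1)
  have h2 := abs_le.1 (h 0 1 1 2)
  have h3 := abs_le.1 (h 0 1 2 3)
  rw [abs_le]
  constructor <;> linarith [h1.1, h1.2, h2.1, h2.2, h3.1, h3.2]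

theorem abs_acDelta_le (hV0 : 0 < V) (hV : ∀ c c', |cov u c c'| ≤ V) (β : ℝ) :
    |acDelta u V β| ≤ 8 := by
  have h : ∀ ξ : K → ℝ, ‖replicaMean (logWeight u β ξ) fun x : Fin 4 → C => acPoly u x / V ^ 2‖ ≤ 8 :=
    fun ξ => abs_replicaMean_le_of_abs_le (abs_acPoly_div_le hV0 hV)
  refine (norm_integral_le_of_norm_le_const (μ := stdGaussianPi K) (ae_of_all _ h)).trans_eq ?_
  simp

/-- The choice `l = √V` balances the two terms, as `expVar` is of order `V` on average over `β`. -/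
theorem abs_acDelta_le_expVar (hV0 : 0 < V) (hV : ∀ c c', |cov u c c'| ≤ V)
    (hd : ∀ c, cov u c c = V) {β : ℝ} (hβ : 0 ≤ β) :
    β * V * |acDelta u V β| ≤ √V + expVar u β / √V := by
  have h := abs_expDiff_le u (F := fun x : Fin 4 → C => cov u (x 0) (x 1) / V)
    (fun x => abs_cov_div_le hV0 hV _ _) 0 2 β (Real.sqrt_pos.2 hV0)
  rwa [expDiff_eq_mul_acDelta hV0 hd, abs_mul, abs_of_nonneg (by positivity)] at h

/-- Both `16 * expMean ± expDiff` have nonnegative derivative. -/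
theorem abs_expDiff_le_add {F : (Fin 4 → C) → ℝ} (hF : ∀ x, |F x| ≤ 1) (a b : Fin 4)
    {β γ : ℝ} (h : β ≤ γ) :
    |expDiff u F a b β| ≤ |expDiff u F a b γ| + 16 * (expMean u γ - expMean u β) := by
  choose D hD hD' using exists_hasDerivAt_expDiff u hF a b
  have h1 : Monotone fun t => 16 * expMean u t - expDiff u F a b t := by
    refine monotone_of_hasDerivAt_nonneg (f' := fun t => 16 * expVar u t - D t)
      (fun t => ((hasDerivAt_expMean u t).const_mul 16).sub (hD t)) fun t => ?_
    simpa using (le_abs_self _).trans (hD' t)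
  have h2 : Monotone fun t => 16 * expMean u t + expDiff u F a b t := by
    refine monotone_of_hasDerivAt_nonneg (f' := fun t => 16 * expVar u t + D t)
      (fun t => ((hasDerivAt_expMean u t).const_mul 16).add (hD t)) fun t => ?_
    simp only [Pi.zero_apply]
    linarith [neg_abs_le (D t), hD' t]
  have h3 := h1 h
  have h4 := h2 h
  simp only at h3 h4
  rw [abs_le]
  constructor <;> linarith [le_abs_self (expDiff u F a b γ), neg_abs_le (expDiff u F a b γ)]

theorem abs_acDelta_le_expMean_sub (hV0 : 0 < V) (hV : ∀ c c', |cov u c c'| ≤ V)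
    (hd : ∀ c, cov u c c = V) {β δ : ℝ} (hβ : 0 ≤ β) (hδ : 0 < δ) :
    β * V * |acDelta u V β| ≤ √V + (expMean u (β + δ) - expMean u β) / δ / √V
      + 16 * (expMean u (β + δ) - expMean u β) := by
  have hF : ∀ x : Fin 4 → C, |cov u (x 0) (x 1) / V| ≤ 1 := fun x => abs_cov_div_le hV0 hV _ _
  -- The variance may be large at `β` itself, but at `γ` it equals the mean slope of `expMean`.
  obtain ⟨γ, hγ, hγ'⟩ := exists_hasDerivAt_eq_slope (expMean u) (expVar u)
    (lt_add_of_pos_right β hδ)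
    (fun t _ => (hasDerivAt_expMean u t).continuousAt.continuousWithinAt)
    fun t _ => hasDerivAt_expMean u t
  rw [add_sub_cancel_left] at hγ'
  have h1 := abs_expDiff_le_add (u := u) hF 0 2 hγ.1.le
  have h2 := abs_expDiff_le u hF 0 2 γ (Real.sqrt_pos.2 hV0)
  have h3 := monotone_expMean u hγ.2.le
  rw [expDiff_eq_mul_acDelta hV0 hd β, abs_mul, abs_of_nonneg (by positivity)] at h1
  rw [hγ'] at h2
  linarith

/-- By convexity of `expLogZ`, its derivative at `β + δ` is at most the slope to the right, and its
derivative at `β` at least the slope to the left. -/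
theorem expMean_sub_le (β : ℝ) {δ : ℝ} (hδ : 0 < δ) :
    expMean u (β + δ) - expMean u β
      ≤ (expLogZ u (β + 2 * δ) - expLogZ u (β + δ)) / δ
        - (expLogZ u β - expLogZ u (β - δ)) / δ := by
  have hc : ∀ s : Set ℝ, ContinuousOn (expLogZ u) s := fun s t _ =>
    (hasDerivAt_expLogZ u t).continuousAt.continuousWithinAt
  obtain ⟨γ, hγ, hγ'⟩ := exists_hasDerivAt_eq_slope (expLogZ u) (expMean u)
    (show β + δ < β + 2 * δ by linarith) (hc _) fun t _ => hasDerivAt_expLogZ u t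
  obtain ⟨η, hη, hη'⟩ := exists_hasDerivAt_eq_slope (expLogZ u) (expMean u)
    (show β - δ < β by linarith) (hc _) fun t _ => hasDerivAt_expLogZ u t
  rw [show β + 2 * δ - (β + δ) = δ by ring] at hγ'
  rw [show β - (β - δ) = δ by ring] at hη'
  rw [← hγ', ← hη']
  exact sub_le_sub (monotone_expMean u hγ.1.le) (monotone_expMean u hη.2.le)

theorem lintegral_abs_acDelta_le (hV0 : 0 < V) (hV : ∀ c c', |cov u c c'| ≤ V)
    (hd : ∀ c, cov u c c = V) {B δ : ℝ} (hδ : 0 < δ) (hB : δ ≤ B) :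
    ∫⁻ β in Set.Ioc 0 B, ENNReal.ofReal |acDelta u V β|
      ≤ ENNReal.ofReal (8 * δ + 3 * B / (δ * √V)) := by
  have hs := Real.sqrt_pos.2 hV0
  have hss := Real.mul_self_sqrt hV0.le
  rw [← Set.Ioc_union_Ioc_eq_Ioc hδ.le hB, ENNReal.ofReal_add (by positivity)
    (div_nonneg (by linarith) (by positivity))]
  -- On `(0, δ]`, where dividing by `β` is harmful, the trivial bound 8 is used; on `(δ, B]` the
  -- variance bound is divided by `β V ≥ δ V`.
  refine (lintegral_union_le _ _ _).trans (add_le_add ?_ ?_)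
  · refine (lintegral_mono fun β => ENNReal.ofReal_le_ofReal (abs_acDelta_le hV0 hV β)).trans_eq ?_
    rw [setLIntegral_const, Real.volume_Ioc, ← ENNReal.ofReal_mul (by norm_num), sub_zero]
  · have hi : IntegrableOn (expVar u) (Set.Ioc δ B) :=
      intervalIntegral.integrableOn_deriv_of_nonneg
        (fun t _ => (hasDerivAt_expMean u t).continuousAt.continuousWithinAt)
        (fun t _ => hasDerivAt_expMean u t) fun t _ => expVar_nonneg u t
    have hI : ∫ β in Set.Ioc δ B, expVar u β = expMean u B - expMean u δ := by
      rw [← intervalIntegral.integral_of_le hB]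
      exact intervalIntegral.integral_eq_sub_of_hasDerivAt (fun t _ => hasDerivAt_expMean u t)
        ((intervalIntegrable_iff_integrableOn_Ioc_of_le hB).2 hi)
    have hg : IntegrableOn (fun β => (√V + expVar u β / √V) / (δ * V)) (Set.Ioc δ B) :=
      ((integrable_const _).add (hi.div_const _)).div_const _
    have hle : ∀ β ∈ Set.Ioc δ B,
        ENNReal.ofReal |acDelta u V β| ≤ ENNReal.ofReal ((√V + expVar u β / √V) / (δ * V)) := by
      intro β hβ
      refine ENNReal.ofReal_le_ofReal ?_
      rw [le_div_iff₀ (by positivity)]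
      refine le_trans ?_ (abs_acDelta_le_expVar hV0 hV hd (hδ.le.trans hβ.1.le))
      rw [mul_comm]
      have := hβ.1.le
      gcongr
    refine (setLIntegral_mono' measurableSet_Ioc hle).trans ?_
    rw [← ofReal_integral_eq_lintegral_ofReal hg (ae_of_all _ fun β => div_nonneg
      (add_nonneg hs.le (div_nonneg (expVar_nonneg u β) hs.le)) (by positivity))]
    refine ENNReal.ofReal_le_ofReal ?_
    rw [integral_div, integral_add (integrable_const _) (hi.div_const _), integral_div, hI]
    have h0 := (expMean_mem_Icc hV hδ.le hd).1
    have h1 := (expMean_mem_Icc hV (hδ.le.trans hB) hd).2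
    simp only [integral_const, MeasurableSet.univ, measureReal_restrict_apply, Set.univ_inter,
      Real.volume_real_Ioc_of_le hB, smul_eq_mul]
    have h2 : (expMean u B - expMean u δ) / √V ≤ 2 * B * √V := by
      rw [div_le_iff₀ hs]
      nlinarith
    calc ((B - δ) * √V + (expMean u B - expMean u δ) / √V) / (δ * V)
        ≤ (3 * B * √V) / (δ * V) := by
          gcongr
          nlinarith
      _ = 3 * B / (δ * √V) := by
          rw [div_eq_div_iff (by positivity) (by positivity)]
          linear_combination (3 * B * δ) * hss

theorem continuous_integral_replicaMean {s : ℕ} (F : (Fin s → C) → ℝ) :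
    Continuous fun β => ∫ ξ, replicaMean (logWeight u β ξ) F ∂(stdGaussianPi K) := by
  obtain ⟨A, hA⟩ := (Set.finite_range fun x => |F x|).bddAbove
  refine continuous_of_dominated (bound := fun _ => A)
    (fun β => (continuous_replicaMean_logWeight u β _).aestronglyMeasurable)
    (fun β => ae_of_all _ fun ξ => abs_replicaMean_le_of_abs_le fun x => hA ⟨x, rfl⟩)
    (integrable_const _) (ae_of_all _ fun ξ => ?_)
  exact continuous_replicaMean (fun c => continuous_id.mul continuous_const) fun _ =>
    continuous_const

end Gibbs

end

/-! ### The bipartite model as a Gaussian field -/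

noncomputable section

namespace BipartiteSpinGlass

variable {N₁ N₂ : ℕ}

/-- The coefficients of the couplings in the field `-H`. -/
def coupling (N₁ N₂ : ℕ) (k : Fin N₁ × Fin N₂) (c : Config N₁ N₂) : ℝ :=
  √(2 / ((N₁ : ℝ) + (N₂ : ℝ))) * (spin (c.1 k.1) * spin (c.2 k.2))

/-- The variance of the Hamiltonian. -/
def energyVar (N₁ N₂ : ℕ) : ℝ := 2 / ((N₁ : ℝ) + N₂) * (N₁ * N₂)

/-- The finite-volume Aizenman-Contucci combination. -/
def acAverage (N₁ N₂ : ℕ) (β : ℝ) : ℝ :=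
  avg1212 N₁ N₂ β - 4 * avg1223 N₁ N₂ β + 3 * avg1234 N₁ N₂ β

theorem spin_mul_self (s : ℤˣ) : spin s * spin s = 1 := by
  unfold spin
  rw [← Int.cast_mul, ← Units.val_mul, Int.units_mul_self]
  simp

theorem abs_spin (s : ℤˣ) : |spin s| = 1 := by
  rw [← sq_eq_sq₀ (abs_nonneg _) one_pos.le, sq_abs, sq, spin_mul_self, one_pow]

theorem field_coupling (ξ : Disorder N₁ N₂) (c : Config N₁ N₂) :
    Gibbs.field (coupling N₁ N₂) ξ c = -hamiltonian ξ c := by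
  rw [Gibbs.field, Fintype.sum_prod_type, hamiltonian, neg_mul, neg_neg, Finset.mul_sum]
  refine Finset.sum_congr rfl fun i _ => ?_
  rw [Finset.mul_sum]
  refine Finset.sum_congr rfl fun j _ => ?_
  rw [coupling]; ring

theorem logWeight_coupling (β : ℝ) (ξ : Disorder N₁ N₂) (c : Config N₁ N₂) :
    Gibbs.logWeight (coupling N₁ N₂) β ξ c = -β * hamiltonian ξ c := by
  rw [Gibbs.logWeight, field_coupling]; ring

theorem boltzmann_eq_weight (β : ℝ) (ξ : Disorder N₁ N₂) (c : Config N₁ N₂) :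
    boltzmann β ξ c = Gibbs.weight (Gibbs.logWeight (coupling N₁ N₂) β ξ) c := by
  simp only [boltzmann, partitionFn, Gibbs.weight, logWeight_coupling]

theorem average_eq {s : ℕ} (β : ℝ) (F : (Fin s → Config N₁ N₂) → ℝ) :
    average s β F = ∫ ξ, Gibbs.replicaMean (Gibbs.logWeight (coupling N₁ N₂) β ξ) F
      ∂(stdGaussianPi (Fin N₁ × Fin N₂)) := by
  simp only [average, replicaState, boltzmann_eq_weight, Gibbs.replicaMean, disorderLaw]

theorem pressure_eq (β : ℝ) :
    pressure N₁ N₂ β = Gibbs.expLogZ (coupling N₁ N₂) β / ((N₁ : ℝ) + N₂) := by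
  simp only [pressure, Gibbs.expLogZ, partitionFn, logWeight_coupling, disorderLaw]
  ring

theorem continuous_acAverage (N₁ N₂ : ℕ) : Continuous (acAverage N₁ N₂) := by
  unfold acAverage avg1212 avg1223 avg1234
  simp only [average_eq]
  exact ((Gibbs.continuous_integral_replicaMean _).sub
    ((Gibbs.continuous_integral_replicaMean _).const_mul 4)).add
    ((Gibbs.continuous_integral_replicaMean _).const_mul 3)

theorem cov_coupling (c c' : Config N₁ N₂) :
    Gibbs.cov (coupling N₁ N₂) c c' = 2 / ((N₁ : ℝ) + N₂) *
      ((∑ i, spin (c.1 i) * spin (c'.1 i)) * ∑ j, spin (c.2 j) * spin (c'.2 j)) := by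
  have hs : √(2 / ((N₁ : ℝ) + N₂)) * √(2 / ((N₁ : ℝ) + N₂)) = 2 / ((N₁ : ℝ) + N₂) :=
    Real.mul_self_sqrt (by positivity)
  rw [Gibbs.cov, Fintype.sum_prod_type, Finset.sum_mul_sum, Finset.mul_sum]
  refine Finset.sum_congr rfl fun i _ => ?_
  rw [Finset.mul_sum]
  refine Finset.sum_congr rfl fun j _ => ?_
  rw [← hs, coupling, coupling]; ring

theorem cov_coupling_self (c : Config N₁ N₂) :
    Gibbs.cov (coupling N₁ N₂) c c = energyVar N₁ N₂ := by
  simp [cov_coupling, spin_mul_self, energyVar]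

theorem abs_cov_coupling_le (c c' : Config N₁ N₂) :
    |Gibbs.cov (coupling N₁ N₂) c c'| ≤ energyVar N₁ N₂ := by
  have h : ∀ (n : ℕ) (x y : Fin n → ℤˣ), |∑ i, spin (x i) * spin (y i)| ≤ n := by
    intro n x y
    refine (Finset.abs_sum_le_sum_abs _ _).trans_eq ?_
    simp [abs_mul, abs_spin]
  rw [cov_coupling, energyVar, abs_mul, abs_mul, abs_of_nonneg (by positivity)]
  gcongr <;> exact h _ _ _

theorem cov_coupling_eq_overlap {s : ℕ} (h₁ : 0 < N₁) (h₂ : 0 < N₂)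
    (x : Fin s → Config N₁ N₂) (a b : Fin s) :
    Gibbs.cov (coupling N₁ N₂) (x a) (x b) = energyVar N₁ N₂ * (q x a b * p x a b) := by
  rw [cov_coupling, energyVar, q, p]
  field_simp

theorem energyVar_pos (h₁ : 0 < N₁) (h₂ : 0 < N₂) : 0 < energyVar N₁ N₂ := by
  unfold energyVar; positivity

theorem acAverage_eq_acDelta (h₁ : 0 < N₁) (h₂ : 0 < N₂) (β : ℝ) :
    acAverage N₁ N₂ β = Gibbs.acDelta (coupling N₁ N₂) (energyVar N₁ N₂) β := by
  have hi : ∀ F : (Fin 4 → Config N₁ N₂) → ℝ, Integrable (fun ξ =>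
      Gibbs.replicaMean (Gibbs.logWeight (coupling N₁ N₂) β ξ) F)
      (stdGaussianPi (Fin N₁ × Fin N₂)) := by
    intro F
    obtain ⟨A, hA⟩ := (Set.finite_range fun x => |F x|).bddAbove
    exact Integrable.of_bound
      (Gibbs.continuous_replicaMean_logWeight _ β F).aestronglyMeasurable A
      (ae_of_all _ fun ξ => Gibbs.abs_replicaMean_le_of_abs_le fun x => hA ⟨x, rfl⟩)
  have hV := (energyVar_pos h₁ h₂).ne'
  unfold acAverage avg1212 avg1223 avg1234 Gibbs.acDelta
  simp only [average_eq]
  rw [← integral_const_mul, ← integral_const_mul, ← integral_sub (hi _) ((hi _).const_mul 4)]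
  refine (integral_add ((hi _).sub ((hi _).const_mul 4)) ((hi _).const_mul 3)).symm.trans ?_
  refine integral_congr_ae (ae_of_all _ fun ξ => ?_)
  simp only [Pi.sub_apply]
  rw [← Gibbs.replicaMean_const_mul, ← Gibbs.replicaMean_const_mul, ← Gibbs.replicaMean_sub,
    ← Gibbs.replicaMean_add]
  congr 1
  ext x
  simp only [Gibbs.acPoly, cov_coupling_eq_overlap h₁ h₂]
  field_simp

theorem monotoneOn_pressure (h₁ : 0 < N₁) (h₂ : 0 < N₂) :
    MonotoneOn (pressure N₁ N₂) (Set.Ici 0) := by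
  have h : MonotoneOn (Gibbs.expLogZ (coupling N₁ N₂)) (Set.Ici 0) := by
    refine monotoneOn_of_deriv_nonneg (convex_Ici 0)
      (fun t _ => (Gibbs.hasDerivAt_expLogZ _ t).continuousAt.continuousWithinAt)
      (fun t _ => (Gibbs.hasDerivAt_expLogZ _ t).differentiableAt.differentiableWithinAt)
      fun t ht => ?_
    rw [(Gibbs.hasDerivAt_expLogZ _ t).deriv]
    exact (Gibbs.expMean_mem_Icc abs_cov_coupling_le (interior_subset ht) cov_coupling_self).1
  intro x hx y hy hxy
  rw [pressure_eq, pressure_eq]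
  have := h hx hy hxy
  gcongr

/-- The difference of two difference quotients of the pressure. -/
def slopeGap (A : ℝ → ℝ) (β δ : ℝ) : ℝ :=
  (A (β + 2 * δ) - A (β + δ)) / δ - (A β - A (β - δ)) / δ

theorem abs_acAverage_le_slopeGap (h₁ : 0 < N₁) (h₂ : 0 < N₂) {β δ : ℝ} (hβ : 0 < β)
    (hδ : 0 < δ) :
    |acAverage N₁ N₂ β| ≤ β⁻¹ * ((√(energyVar N₁ N₂))⁻¹
      + ((N₁ : ℝ) + N₂) / energyVar N₁ N₂ * slopeGap (pressure N₁ N₂) β δ / δ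
        * (√(energyVar N₁ N₂))⁻¹
      + 16 * (((N₁ : ℝ) + N₂) / energyVar N₁ N₂ * slopeGap (pressure N₁ N₂) β δ)) := by
  set V := energyVar N₁ N₂ with hVdef
  have hV : 0 < V := energyVar_pos h₁ h₂
  have hs := Real.sqrt_pos.2 hV
  have hss := Real.mul_self_sqrt hV.le
  have hN : (0 : ℝ) < (N₁ : ℝ) + N₂ := by positivity
  rw [acAverage_eq_acDelta h₁ h₂]
  have h := Gibbs.abs_acDelta_le_expMean_sub (u := coupling N₁ N₂) hV abs_cov_coupling_le
    cov_coupling_self hβ.le hδ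
  have hE := Gibbs.expMean_sub_le (u := coupling N₁ N₂) β hδ
  have hE' : Gibbs.expMean (coupling N₁ N₂) (β + δ) - Gibbs.expMean (coupling N₁ N₂) β
      ≤ ((N₁ : ℝ) + N₂) * slopeGap (pressure N₁ N₂) β δ := by
    refine hE.trans_eq ?_
    simp only [slopeGap, pressure_eq]
    field_simp
  set E := Gibbs.expMean (coupling N₁ N₂) (β + δ) - Gibbs.expMean (coupling N₁ N₂) β
  set S := ((N₁ : ℝ) + N₂) * slopeGap (pressure N₁ N₂) β δ with hS
  have h' : β * V * |Gibbs.acDelta (coupling N₁ N₂) V β| ≤ √V + S / δ / √V + 16 * S := by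
    refine h.trans ?_
    gcongr
  have e : β⁻¹ * ((√V)⁻¹ + ((N₁ : ℝ) + N₂) / V * slopeGap (pressure N₁ N₂) β δ / δ * (√V)⁻¹
      + 16 * (((N₁ : ℝ) + N₂) / V * slopeGap (pressure N₁ N₂) β δ))
      = (√V + S / δ / √V + 16 * S) / (β * V) := by
    have e1 : (√V)⁻¹ = √V / V := by
      rw [inv_eq_one_div, div_eq_div_iff hs.ne' hV.ne', hss, one_mul]
    rw [div_eq_mul_inv (S / δ) (√V), e1, hS]
    field_simp
  rw [e, le_div_iff₀ (by positivity), mul_comm]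
  exact h'

theorem tendsto_slopeGap {A : ℝ → ℝ} {β : ℝ} (hA : DifferentiableAt ℝ A β) :
    Tendsto (slopeGap A β) (𝓝[>] 0) (𝓝 0) := by
  have h := hA.hasDerivAt.tendsto_slope_zero
  have hm : ∀ r : ℝ, r ≠ 0 → Tendsto (fun t : ℝ => r * t) (𝓝[>] 0) (𝓝[≠] 0) := by
    intro r hr
    refine tendsto_nhdsWithin_iff.2 ⟨?_, ?_⟩
    · have : Tendsto (fun t : ℝ => r * t) (𝓝 0) (𝓝 (r * 0)) := (continuous_const_mul r).tendsto 0
      rw [mul_zero] at this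
      exact this.mono_left nhdsWithin_le_nhds
    · filter_upwards [self_mem_nhdsWithin] with t ht
      exact mul_ne_zero hr (ne_of_gt ht)
  have h1 := h.comp (hm 1 one_ne_zero)
  have h2 := h.comp (hm 2 two_ne_zero)
  have h3 := h.comp (hm (-1) (by norm_num))
  -- The gap is a combination of slopes based at `β`, with steps `2δ`, `δ`, `-δ` and coefficients
  -- `2, -1, -1` of sum zero.
  have h4 := ((h2.const_mul 2).sub h1).sub h3
  rw [show 2 * deriv A β - deriv A β - deriv A β = 0 by ring] at h4
  refine h4.congr' ?_
  filter_upwards [self_mem_nhdsWithin] with t ht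
  have ht' : t ≠ 0 := ne_of_gt ht
  simp only [Function.comp, smul_eq_mul, slopeGap, one_mul, neg_mul, ← sub_eq_add_neg]
  field_simp
  ring

/-! ### The thermodynamic limit -/

section Limit

variable {α : ℝ} {N₁ N₂ : ℕ → ℕ}

theorem tendsto_energyVar (hα0 : 0 < α) (hN₂ : Tendsto N₂ atTop atTop)
    (hα : Tendsto (fun n => (N₁ n : ℝ) / ((N₁ n : ℝ) + (N₂ n : ℝ))) atTop (𝓝 α)) :
    Tendsto (fun n => energyVar (N₁ n) (N₂ n)) atTop atTop := by
  have h : Tendsto (fun n => 2 * ((N₁ n : ℝ) / ((N₁ n : ℝ) + (N₂ n : ℝ))) * (N₂ n : ℝ)) atTop atTop :=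
    (hα.const_mul 2).pos_mul_atTop (by positivity) (tendsto_natCast_atTop_atTop.comp hN₂)
  refine h.congr fun n => ?_
  rw [energyVar]; ring

theorem tendsto_volume_div_energyVar (hα0 : 0 < α) (hα1 : α < 1) (hN₁ : Tendsto N₁ atTop atTop)
    (hN₂ : Tendsto N₂ atTop atTop)
    (hα : Tendsto (fun n => (N₁ n : ℝ) / ((N₁ n : ℝ) + (N₂ n : ℝ))) atTop (𝓝 α)) :
    Tendsto (fun n => ((N₁ n : ℝ) + N₂ n) / energyVar (N₁ n) (N₂ n)) atTop
      (𝓝 (2 * α * (1 - α))⁻¹) := by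
  have h := ((hα.const_mul 2).mul (hα.const_sub 1)).inv₀
    (mul_pos (mul_pos two_pos hα0) (sub_pos.2 hα1)).ne'
  refine h.congr' ?_
  filter_upwards [hN₁.eventually_gt_atTop 0, hN₂.eventually_gt_atTop 0] with n h1 h2
  have e : 1 - (N₁ n : ℝ) / ((N₁ n : ℝ) + N₂ n) = N₂ n / ((N₁ n : ℝ) + N₂ n) := by
    field_simp
    ring
  rw [energyVar, e]
  field_simp

theorem tendsto_acAverage_of_tendsto_pressure (hα0 : 0 < α) (hα1 : α < 1)
    (hN₁ : Tendsto N₁ atTop atTop) (hN₂ : Tendsto N₂ atTop atTop)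
    (hα : Tendsto (fun n => (N₁ n : ℝ) / ((N₁ n : ℝ) + (N₂ n : ℝ))) atTop (𝓝 α)) {A : ℝ → ℝ}
    (hA : ∀ β, 0 < β → Tendsto (fun n => pressure (N₁ n) (N₂ n) β) atTop (𝓝 (A β)))
    {β : ℝ} (hβ : 0 < β) (hd : DifferentiableAt ℝ A β) :
    Tendsto (fun n => acAverage (N₁ n) (N₂ n) β) atTop (𝓝 0) := by
  rw [tendsto_zero_iff_abs_tendsto_zero]
  refine tendsto_order.2 ⟨fun a ha => Eventually.of_forall fun n => ha.trans_le (abs_nonneg _),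
    fun ε hε => ?_⟩
  have hlim : Tendsto (fun δ => β⁻¹ * (16 * ((2 * α * (1 - α))⁻¹ * slopeGap A β δ))) (𝓝[>] 0)
      (𝓝 (β⁻¹ * (16 * ((2 * α * (1 - α))⁻¹ * 0)))) :=
    (((tendsto_slopeGap hd).const_mul _).const_mul _).const_mul _
  simp only [mul_zero] at hlim
  -- The step is fixed before `n → ∞`; `δ < β` keeps `β - δ` positive, where the pressure converges.
  obtain ⟨δ, hδε, hδ0, hδβ⟩ := ((hlim.eventually (gt_mem_nhds hε)).and
    (Ioo_mem_nhdsGT hβ)).exists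
  have hV := (tendsto_inv_atTop_zero.comp
    (Real.tendsto_sqrt_atTop.comp (tendsto_energyVar hα0 hN₂ hα)))
  have hgap : Tendsto (fun n => slopeGap (pressure (N₁ n) (N₂ n)) β δ) atTop
      (𝓝 (slopeGap A β δ)) :=
    (((hA _ (by linarith)).sub (hA _ (by linarith))).div_const δ).sub
      (((hA _ hβ).sub (hA _ (by linarith))).div_const δ)
  have hM := (tendsto_volume_div_energyVar hα0 hα1 hN₁ hN₂ hα).mul hgap
  have hR := ((hV.add ((hM.div_const δ).mul hV)).add (hM.const_mul 16)).const_mul β⁻¹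
  rw [mul_zero, add_zero, zero_add] at hR
  filter_upwards [hR.eventually (gt_mem_nhds hδε), hN₁.eventually_gt_atTop 0,
    hN₂.eventually_gt_atTop 0] with n hn h1 h2
  exact (abs_acAverage_le_slopeGap h1 h2 hβ hδ0).trans_lt hn

/-- A pointwise limit of monotone functions is monotone, and Lebesgue's differentiation theorem
applies. -/
theorem ae_differentiableAt_of_tendsto_pressure (hN₁ : Tendsto N₁ atTop atTop)
    (hN₂ : Tendsto N₂ atTop atTop) {A : ℝ → ℝ}
    (hA : ∀ β, 0 < β → Tendsto (fun n => pressure (N₁ n) (N₂ n) β) atTop (𝓝 (A β))) :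
    ∀ᵐ β : ℝ, 0 < β → DifferentiableAt ℝ A β := by
  have hm : MonotoneOn A (Set.Ioi 0) := by
    intro x hx y hy hxy
    refine le_of_tendsto_of_tendsto (hA x hx) (hA y hy) ?_
    filter_upwards [hN₁.eventually_gt_atTop 0, hN₂.eventually_gt_atTop 0] with n h1 h2
    exact monotoneOn_pressure h1 h2 (Set.mem_Ici.2 (le_of_lt hx)) (Set.mem_Ici.2 (le_of_lt hy)) hxy
  filter_upwards [hm.ae_differentiableWithinAt_of_mem] with β h hβ
  exact (h hβ).differentiableAt (Ioi_mem_nhds hβ)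

theorem tendsto_lintegral_acAverage (hα0 : 0 < α)
    (hN₁ : Tendsto N₁ atTop atTop) (hN₂ : Tendsto N₂ atTop atTop)
    (hα : Tendsto (fun n => (N₁ n : ℝ) / ((N₁ n : ℝ) + (N₂ n : ℝ))) atTop (𝓝 α))
    {B : ℝ} (hB : 0 < B) :
    Tendsto (fun n => ∫⁻ β in Set.Ioc 0 B, ENNReal.ofReal |acAverage (N₁ n) (N₂ n) β|) atTop
      (𝓝 0) := by
  -- The cutoff `δ = V^(-1/4)` makes `8δ` and `3B/(δ√V)` both of order `V^(-1/4)`.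
  have hW : Tendsto (fun n => √√(energyVar (N₁ n) (N₂ n))) atTop atTop :=
    Real.tendsto_sqrt_atTop.comp
      (Real.tendsto_sqrt_atTop.comp (tendsto_energyVar hα0 hN₂ hα))
  have hW' := tendsto_inv_atTop_zero.comp hW
  have hR := ENNReal.tendsto_ofReal ((hW'.const_mul 8).add (hW'.const_mul (3 * B)))
  simp only [mul_zero, add_zero, ENNReal.ofReal_zero] at hR
  refine tendsto_of_tendsto_of_tendsto_of_le_of_le' tendsto_const_nhds hR
    (Eventually.of_forall fun _ => zero_le) ?_
  filter_upwards [hN₁.eventually_gt_atTop 0, hN₂.eventually_gt_atTop 0,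
    hW'.eventually (ge_mem_nhds hB)] with n h1 h2 h3
  have hV := energyVar_pos h1 h2
  have hs := Real.sqrt_pos.2 hV
  have hss := Real.sqrt_pos.2 hs
  simp only [acAverage_eq_acDelta h1 h2]
  refine (Gibbs.lintegral_abs_acDelta_le hV abs_cov_coupling_le cov_coupling_self
    (inv_pos.2 hss) h3).trans_eq ?_
  have e : (√√(energyVar (N₁ n) (N₂ n)))⁻¹ * √(energyVar (N₁ n) (N₂ n))
      = √√(energyVar (N₁ n) (N₂ n)) := by
    rw [inv_mul_eq_div, div_eq_iff hss.ne', Real.mul_self_sqrt hs.le]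
  rw [e]
  rfl

theorem ae_liminf_acAverage_eq_zero (hα0 : 0 < α)
    (hN₁ : Tendsto N₁ atTop atTop) (hN₂ : Tendsto N₂ atTop atTop)
    (hα : Tendsto (fun n => (N₁ n : ℝ) / ((N₁ n : ℝ) + (N₂ n : ℝ))) atTop (𝓝 α)) :
    ∀ᵐ β : ℝ, 0 < β →
      liminf (fun n => ENNReal.ofReal |acAverage (N₁ n) (N₂ n) β|) atTop = 0 := by
  have hmeas : ∀ n, Measurable fun β => ENNReal.ofReal |acAverage (N₁ n) (N₂ n) β| := fun n =>
    ((continuous_acAverage _ _).measurable.abs).ennreal_ofReal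
  have h : ∀ k : ℕ, ∀ᵐ β : ℝ, β ∈ Set.Ioc (0 : ℝ) (k + 1) →
      liminf (fun n => ENNReal.ofReal |acAverage (N₁ n) (N₂ n) β|) atTop = 0 := by
    intro k
    rw [← ae_restrict_iff' measurableSet_Ioc]
    -- Fatou's lemma: the integral of the `liminf` is at most the limit of the integrals, which is
    -- zero.
    have h0 := lintegral_liminf_le (μ := volume.restrict (Set.Ioc (0 : ℝ) (k + 1)))
      (u := atTop) hmeas
    rw [(tendsto_lintegral_acAverage hα0 hN₁ hN₂ hα (by positivity : (0 : ℝ) < k + 1)).liminf_eq,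
      nonpos_iff_eq_zero, lintegral_eq_zero_iff (Measurable.liminf hmeas)] at h0
    exact h0
  filter_upwards [ae_all_iff.2 h] with β hβ h0
  obtain ⟨k, hk⟩ := exists_nat_ge β
  exact hβ k ⟨h0, hk.trans (by linarith)⟩

end Limit

end BipartiteSpinGlass

end

theorem mainTheorem10 (α : ℝ) (hα0 : 0 < α) (hα1 : α < 1) (N₁ N₂ : ℕ → ℕ)
    (hN₁ : Tendsto N₁ atTop atTop) (hN₂ : Tendsto N₂ atTop atTop)
    (hα : Tendsto (fun n => (N₁ n : ℝ) / ((N₁ n : ℝ) + (N₂ n : ℝ))) atTop (𝓝 α)) :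
    -- If the limiting pressure exists, the identity holds in the limit for almost every `β`.
    (∀ A : ℝ → ℝ,
      (∀ β : ℝ, 0 < β →
        Tendsto (fun n => BipartiteSpinGlass.pressure (N₁ n) (N₂ n) β) atTop (𝓝 (A β))) →
      ∀ᵐ β : ℝ ∂volume, 0 < β →
        Tendsto (fun n => BipartiteSpinGlass.avg1212 (N₁ n) (N₂ n) β
          - 4 * BipartiteSpinGlass.avg1223 (N₁ n) (N₂ n) β
          + 3 * BipartiteSpinGlass.avg1234 (N₁ n) (N₂ n) β) atTop (𝓝 0)) ∧
    -- Unconditionally, for almost every `β`, the limits of the three averages satisfy the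
    -- identity whenever they exist.
    (∀ᵐ β : ℝ ∂volume, 0 < β → ∀ a b c : ℝ,
      Tendsto (fun n => BipartiteSpinGlass.avg1212 (N₁ n) (N₂ n) β) atTop (𝓝 a) →
      Tendsto (fun n => BipartiteSpinGlass.avg1223 (N₁ n) (N₂ n) β) atTop (𝓝 b) →
      Tendsto (fun n => BipartiteSpinGlass.avg1234 (N₁ n) (N₂ n) β) atTop (𝓝 c) →
      a - 4 * b + 3 * c = 0) ∧
    -- Unconditionally, the identity holds in the limit in `L¹` on bounded `β`-intervals.
    (∀ B : ℝ, 0 < B →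
      Tendsto (fun n => ∫⁻ β in Set.Ioc 0 B,
        ENNReal.ofReal |BipartiteSpinGlass.avg1212 (N₁ n) (N₂ n) β
          - 4 * BipartiteSpinGlass.avg1223 (N₁ n) (N₂ n) β
          + 3 * BipartiteSpinGlass.avg1234 (N₁ n) (N₂ n) β| ∂volume) atTop (𝓝 0)) := by
  refine ⟨fun A hA => ?_, ?_, fun B hB =>
    BipartiteSpinGlass.tendsto_lintegral_acAverage hα0 hN₁ hN₂ hα hB⟩
  · filter_upwards [BipartiteSpinGlass.ae_differentiableAt_of_tendsto_pressure hN₁ hN₂ hA]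
      with β hd hβ
    exact BipartiteSpinGlass.tendsto_acAverage_of_tendsto_pressure hα0 hα1 hN₁ hN₂ hα hA hβ (hd hβ)
  · filter_upwards [BipartiteSpinGlass.ae_liminf_acAverage_eq_zero hα0 hN₁ hN₂ hα]
      with β h hβ a b c ha hb hc
    have hlim : Tendsto (fun n => ENNReal.ofReal |BipartiteSpinGlass.acAverage (N₁ n) (N₂ n) β|)
        atTop (𝓝 (ENNReal.ofReal |a - 4 * b + 3 * c|)) :=
      ENNReal.tendsto_ofReal ((ha.sub (hb.const_mul 4)).add (hc.const_mul 3)).abs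
    -- When the three limits exist, the vanishing `liminf` is the limit itself.
    have h0 := hlim.liminf_eq.symm.trans (h hβ)
    exact abs_eq_zero.1 (le_antisymm (ENNReal.ofReal_eq_zero.1 h0) (abs_nonneg _))
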